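/- Let $\mathcal P$ be a finite nonempty set of atomic propositions, $\Sigma=2^{\mathcal P}$. For an infinite word $\alpha=\alpha[0]\alpha[1]\cdots\in\Sigma^\omega$ let $\alpha[i,\infty)$ be its suffix from position $i$ and $\alpha[i,j)$ its infix from position $i$ up to and excluding $j$. **Logic.** Atomic expressions: $\xi::=p\mid\neg\xi\mid\xi\vee\xi$ with $p\in\mathcal P$. Regular expressions: $\rho::=\varepsilon\mid\xi\mid\rho+\rho\mid\rho\circ\rho\mid\rho^*$. PSL formulas: $\varphi::=p\mid\neg\varphi\mid\varphi\vee\varphi\mid \mathbf X\varphi\mid\varphi\,\mathbf U\,\varphi\mid\rho\mapsto\varphi$. An atomic expression denotes a set of symbols ($p$ denotes $\{A\in\Sigma: p\in A\}$; $\neg$ is complement, $\vee$ is union), and $\alpha[i,j)\vdash\rho$ ("matches") is the usual membership of the finite word $\alpha[i,j)$ in the language of $\rho$, where $\xi$ matches exactly the one-letter words whose letter it denotes. $\alpha\models\varphi$ is the usual LTL semantics, with $\alpha\models\rho\mapsto\varphi$ iff for all $i\ge1$, $\alpha[0,i)\vdash\rho$ implies $\alpha[i-1,\infty)\models\varphi$.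 The size $|\varphi|$ is the number of distinct subformulas and subexpressions of $\varphi$ (a propositional formula and the same atomic expression count once). A sample $\mathcal S=(P,N)$ consists of two finite sets of ultimately periodic words $uv^\omega$ ($v\ne\varepsilon$), each given by a pair $(u,v)$, such that no word is in both. A formula $\varphi$ is consistent with $\mathcal S$ if all words of $P$ and no word of $N$ satisfy it. **Encoding.** For $n\ge1$ let $b=2^n+1$. The propositional formula $\Phi_n^{\mathcal S}=\Phi_n^{\mathrm{str}}\wedge\Phi_n^{\mathrm{cst}}$ has variables $x_{k,\lambda}$ (node $k$ has label $\lambda$), $l_{k,\ell}$, $r_{k,\ell}$ (node $\ell<k$ is the left, right child of node $k$), $a_k$ (node $k$ is an atomic expression), and, for each word $uv^\omega$ of the sample, $y^{u,v}_{i,k}$ ($0\le i<|uv|$) and $z^{u,v}_{i,j,k}$ ($0\le i\le j\le|uv^b|$); here $1\le k\le n$. Put $\Lambda_A=\{\neg,\vee\}\cup\mathcal P$, $\Lambda_R=\Lambda_A\cup\{\varepsilon,+,\circ,{}^*\}$, $\Lambda_F=\Lambda_A\cup\{\mathbf X,\mathbf U,\mapsto\}$. $\Phi_n^{\mathrm{str}}$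 says: every node has exactly one label in $\Lambda_R\cup\Lambda_F$; every node $k\ge2$ has exactly one left and exactly one right child, both in $\{1,\dots,k-1\}$; both children of a node labelled $+,\circ,{}^*$ have labels in $\Lambda_R$; both children of a node labelled $\mathbf X,\mathbf U,\neg,\vee$ have labels in $\Lambda_F$; the left child of a node labelled $\mapsto$ has a label in $\Lambda_R$ and its right child one in $\Lambda_F$; if $a_k$ holds, then node $k$ has a label in $\Lambda_A$, and $a_\ell$ holds for its left child $\ell$ if the label is $\neg$, and for both its children if it is $\vee$; $a_\ell$ holds for every $\ell$ labelled $\neg$ or $\vee$ that is the left child of a node labelled $+,\circ,{}^*,\mapsto$ or the right child of a node labelled $+,\circ$; node $1$ is labelled $\varepsilon$ or by a proposition; node $n$ has a label in $\Lambda_F$. $\Phi_n^{\mathrm{cst}}$ is $\bigwedge_{uv^\omega\in P}(\Phi_n^{u,v}\wedge y^{u,v}_{0,n})\wedge\bigwedge_{uv^\omega\in N}(\Phi_n^{u,v}\wedge\neg y^{u,v}_{0,n})$. With superscripts omitted, $\Phi_n^{u,v}$ says, for every node $k$ with left child $\ell$ and right child $\ell'$, according to its label: - for all $0\le i\le j\le|uv^b|$: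 $\varepsilon$: $z_{i,j,k}\leftrightarrow[i=j]$; $p$: $z_{i,j,k}\leftrightarrow[j=i+1\text{ and }p\in uv^\omega[i]]$; $\neg$: $z_{i,j,k}\leftrightarrow[j=i+1]\wedge\neg z_{i,j,\ell}$; $\vee$ and $+$: $z_{i,j,k}\leftrightarrow z_{i,j,\ell}\vee z_{i,j,\ell'}$; $\circ$: $z_{i,j,k}\leftrightarrow\bigvee_{i\le t\le j}z_{i,t,\ell}\wedge z_{t,j,\ell'}$; ${}^*$: $z_{i,j,k}\leftrightarrow[i=j]\vee\bigvee_{i<t\le j}z_{i,t,\ell}\wedge z_{t,j,k}$; - for all $0\le i<|uv|$: $p$: $y_{i,k}\leftrightarrow[p\in uv^\omega[i]]$; $\neg$: $y_{i,k}\leftrightarrow\neg y_{i,\ell}$; $\vee$: $y_{i,k}\leftrightarrow y_{i,\ell}\vee y_{i,\ell'}$; $\mathbf X$: $y_{i,k}\leftrightarrow y_{i+1,\ell}$ if $i<|uv|-1$, and $y_{i,k}\leftrightarrow y_{|u|,\ell}$ if $i=|uv|-1$; $\mathbf U$: $y_{i,k}\leftrightarrow\bigvee_{i\le j<|uv|}\big(y_{j,\ell'}\wedge\bigwedge_{i\le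 t<j}y_{t,\ell}\big)$ if $i<|u|$, and $y_{i,k}\leftrightarrow\bigvee_{|u|\le j<|uv|}\big(y_{j,\ell'}\wedge\bigwedge_{t\in I(i,j)}y_{t,\ell}\big)$ if $i\ge|u|$, where $I(i,j)=\{i,\dots,j-1\}$ for $i\le j$ and $\{|u|,\dots,j-1\}\cup\{i,\dots,|uv|-1\}$ for $i>j$; $\mapsto$: $y_{i,k}\leftrightarrow\bigwedge_{i<j\le|uv^b|}\big(z_{i,j,\ell}\to y_{M(j-1),\ell'}\big)$, where $M(j)=j$ for $j<|uv|$ and $M(j)=|u|+((j-|u|)\bmod|v|)$ otherwise. For a model $v$ of $\Phi_n^{\mathcal S}$, $\varphi_v$ is the PSL formula whose syntax tree is obtained by unravelling, from node $n$, the labels and children given by $v$ (ignoring the right child of unary nodes and both children of leaves). **Algorithm 1.** On input $\mathcal S$: for $n=1,2,\dots$ construct $\Phi_n^{\mathcal S}$ and check its satisfiability; as soon as it is satisfiable, with some model $v$, return $\varphi_v$. **Theorem.** For every sample $\mathcal S$, Algorithm 1 terminates (whichever models are found) and returns a PSL formula that is consistent with $\mathcal S$ and has minimal size among all PSL formulas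 consistent with $\mathcal S$. Moreover, for every $n\ge1$, $\Phi_n^{\mathcal S}$ is satisfiable if and only if some PSL formula of size $n$ is consistent with $\mathcal S$, and for every model $v$ of $\Phi_n^{\mathcal S}$ the formula $\varphi_v$ exists, is unique, is consistent with $\mathcal S$ and has size at most $n$. -/

import Mathlib

namespace PSLLearning

/-! ### Ultimately periodic words -/

/-- An infinite word over the alphabet `2^AP`. -/
abbrev InfWord (AP : Type*) := ℕ → Finset AP

/-- The suffix `α[i, ∞)`. -/
def InfWord.suffix {AP : Type*} (α : InfWord AP) (i : ℕ) : InfWord AP := fun j => α (i + j)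

/-- A finite presentation `(u, v)`, `v ≠ ε`, of the ultimately periodic word `u v^ω`. -/
structure UPWord (AP : Type*) where
  u : List (Finset AP)
  v : List (Finset AP)
  v_ne : v ≠ []

/-- The infinite word `u v^ω`. -/
def UPWord.word {AP : Type*} (w : UPWord AP) : InfWord AP := fun i =>
  if h : i < w.u.length then w.u[i]
  else w.v[(i - w.u.length) % w.v.length]'(Nat.mod_lt _ (List.length_pos_iff.mpr w.v_ne))

/-- `|u|` -/
def UPWord.lu {AP : Type*} (w : UPWord AP) : ℕ := w.u.length

/-- `|uv|` -/
def UPWord.luv {AP : Type*} (w : UPWord AP) : ℕ := w.u.length + w.v.length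

/-- `|u v^b|` -/
def UPWord.luvb {AP : Type*} (w : UPWord AP) (b : ℕ) : ℕ := w.u.length + b * w.v.length

/-- The map `M_{u,v}` from positions of `u v^ω` to positions of the prefix `uv`. -/
def UPWord.M {AP : Type*} (w : UPWord AP) (j : ℕ) : ℕ :=
  if j < w.luv then j else w.u.length + (j - w.u.length) % w.v.length

/-! ### Regular expressions and PSL -/

/-- Atomic expressions `ξ ::= p | ¬ξ | ξ ∨ ξ`. -/
inductive AtomExpr (AP : Type*) where
  | prop (p : AP)
  | neg (ξ : AtomExpr AP)
  | or (ξ₁ ξ₂ : AtomExpr AP)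

/-- Regular expressions `ρ ::= ε | ξ | ρ + ρ | ρ ∘ ρ | ρ*`. -/
inductive RegExpr (AP : Type*) where
  | eps
  | atom (ξ : AtomExpr AP)
  | plus (ρ₁ ρ₂ : RegExpr AP)
  | comp (ρ₁ ρ₂ : RegExpr AP)
  | star (ρ : RegExpr AP)

/-- PSL formulas `φ ::= p | ¬φ | φ ∨ φ | X φ | φ U φ | ρ ↦ φ`. -/
inductive PSL (AP : Type*) where
  | prop (p : AP)
  | neg (φ : PSL AP)
  | or (φ₁ φ₂ : PSL AP)
  | next (φ : PSL AP)
  | untl (φ₁ φ₂ : PSL AP)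
  | trig (ρ : RegExpr AP) (φ : PSL AP)

/-- The set of symbols denoted by an atomic expression. -/
def AtomExpr.sem {AP : Type*} : AtomExpr AP → Set (Finset AP)
  | .prop p => {A | p ∈ A}
  | .neg ξ => ξ.semᶜ
  | .or ξ₁ ξ₂ => ξ₁.sem ∪ ξ₂.sem

/-- `[i, j)` can be cut into finitely many nonempty consecutive pieces that all satisfy `R`. -/
inductive StarMatch (R : ℕ → ℕ → Prop) : ℕ → ℕ → Prop where
  | refl (i : ℕ) : StarMatch R i i
  | step {i k j : ℕ} (hik : i < k) (hkj : k ≤ j) (h : R i k) (h' : StarMatch R k j) :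
      StarMatch R i j

/-- The matching relation `α[i, j) ⊢ ρ`. -/
def Matches {AP : Type*} (α : InfWord AP) : RegExpr AP → ℕ → ℕ → Prop
  | .eps, i, j => j = i
  | .atom ξ, i, j => j = i + 1 ∧ α i ∈ ξ.sem
  | .plus ρ₁ ρ₂, i, j => Matches α ρ₁ i j ∨ Matches α ρ₂ i j
  | .comp ρ₁ ρ₂, i, j => ∃ k, i ≤ k ∧ k ≤ j ∧ Matches α ρ₁ i k ∧ Matches α ρ₂ k j
  | .star ρ, i, j => StarMatch (Matches α ρ) i j

/-- The satisfaction relation `α ⊨ φ`. -/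
def Sat {AP : Type*} : InfWord AP → PSL AP → Prop
  | α, .prop p => p ∈ α 0
  | α, .neg φ => ¬ Sat α φ
  | α, .or φ₁ φ₂ => Sat α φ₁ ∨ Sat α φ₂
  | α, .next φ => Sat (α.suffix 1) φ
  | α, .untl φ₁ φ₂ => ∃ j, Sat (α.suffix j) φ₂ ∧ ∀ i < j, Sat (α.suffix i) φ₁
  | α, .trig ρ φ => ∀ i, 0 < i → Matches α ρ 0 i → Sat (α.suffix (i - 1)) φ

/-! ### Syntax trees and size

Formulas and regular expressions share one type of syntax trees, in which a propositional formula
and the same atomic expression are the same tree: so `(p ∘ q) ↦ X q` has size `5`. -/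

inductive SynTree (AP : Type*) where
  | prop (p : AP)
  | eps
  | neg (t : SynTree AP)
  | or (t₁ t₂ : SynTree AP)
  | next (t : SynTree AP)
  | untl (t₁ t₂ : SynTree AP)
  | trig (t₁ t₂ : SynTree AP)
  | plus (t₁ t₂ : SynTree AP)
  | comp (t₁ t₂ : SynTree AP)
  | star (t : SynTree AP)
  deriving DecidableEq

/-- The set of all subtrees, including the tree itself. -/
def SynTree.subtrees {AP : Type*} [DecidableEq AP] : SynTree AP → Finset (SynTree AP)
  | .prop p => {.prop p}
  | .eps => {.eps}
  | .neg t => insert (.neg t) t.subtrees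
  | .or t₁ t₂ => insert (.or t₁ t₂) (t₁.subtrees ∪ t₂.subtrees)
  | .next t => insert (.next t) t.subtrees
  | .untl t₁ t₂ => insert (.untl t₁ t₂) (t₁.subtrees ∪ t₂.subtrees)
  | .trig t₁ t₂ => insert (.trig t₁ t₂) (t₁.subtrees ∪ t₂.subtrees)
  | .plus t₁ t₂ => insert (.plus t₁ t₂) (t₁.subtrees ∪ t₂.subtrees)
  | .comp t₁ t₂ => insert (.comp t₁ t₂) (t₁.subtrees ∪ t₂.subtrees)
  | .star t => insert (.star t) t.subtrees

def AtomExpr.tree {AP : Type*} : AtomExpr AP → SynTree AP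
  | .prop p => .prop p
  | .neg ξ => .neg ξ.tree
  | .or ξ₁ ξ₂ => .or ξ₁.tree ξ₂.tree

def RegExpr.tree {AP : Type*} : RegExpr AP → SynTree AP
  | .eps => .eps
  | .atom ξ => ξ.tree
  | .plus ρ₁ ρ₂ => .plus ρ₁.tree ρ₂.tree
  | .comp ρ₁ ρ₂ => .comp ρ₁.tree ρ₂.tree
  | .star ρ => .star ρ.tree

def PSL.tree {AP : Type*} : PSL AP → SynTree AP
  | .prop p => .prop p
  | .neg φ => .neg φ.tree
  | .or φ₁ φ₂ => .or φ₁.tree φ₂.tree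
  | .next φ => .next φ.tree
  | .untl φ₁ φ₂ => .untl φ₁.tree φ₂.tree
  | .trig ρ φ => .trig ρ.tree φ.tree

/-- The size of a formula: its number of distinct subformulas and subexpressions. -/
def PSL.size {AP : Type*} [DecidableEq AP] (φ : PSL AP) : ℕ := φ.tree.subtrees.card

/-! ### Samples -/

/-- A sample: two finite sets of (presentations of) ultimately periodic words such that no word
is both positive and negative. -/
structure Sample (AP : Type*) where
  P : Finset (UPWord AP)
  N : Finset (UPWord AP)
  disjoint : ∀ w ∈ P, ∀ w' ∈ N, w.word ≠ w'.word

def Sample.Consistent {AP : Type*} (S : Sample AP) (φ : PSL AP) : Prop :=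
  (∀ w ∈ S.P, Sat w.word φ) ∧ ∀ w ∈ S.N, ¬ Sat w.word φ

/-! ### Propositional logic -/

/-- Propositional formulas over a set `V` of variables. -/
inductive PropForm (V : Type*) where
  | var (x : V)
  | ff
  | neg (Φ : PropForm V)
  | or (Φ Ψ : PropForm V)

namespace PropForm

variable {V ι : Type*}

def Holds (v : V → Bool) : PropForm V → Prop
  | .var x => v x = true
  | .ff => False
  | .neg Φ => ¬ Holds v Φ
  | .or Φ Ψ => Holds v Φ ∨ Holds v Ψ

def Satisfiable (Φ : PropForm V) : Prop := ∃ v : V → Bool, Holds v Φ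

def tt : PropForm V := neg ff
def and (Φ Ψ : PropForm V) : PropForm V := neg (or (neg Φ) (neg Ψ))
def imp (Φ Ψ : PropForm V) : PropForm V := or (neg Φ) Ψ
def iff (Φ Ψ : PropForm V) : PropForm V := and (imp Φ Ψ) (imp Ψ Φ)

/-- The constant `[c]` for a condition `c` that does not depend on the variables. -/
def const (c : Prop) [Decidable c] : PropForm V := if c then tt else ff

/-- Finite conjunction of a list of formulas. -/
def all (L : List (PropForm V)) : PropForm V := L.foldr and tt

/-- Finite disjunction of a list of formulas. -/
def any (L : List (PropForm V)) : PropForm V := L.foldr or ff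

/-- `⋀_{i ∈ L} f i` -/
def bigAnd (L : List ι) (f : ι → PropForm V) : PropForm V := all (L.map f)

/-- `⋁_{i ∈ L} f i` -/
def bigOr (L : List ι) (f : ι → PropForm V) : PropForm V := any (L.map f)

end PropForm

/-! ### The variables of the encoding -/

/-- The labels of the nodes of a syntax DAG. -/
inductive Label (AP : Type*) where
  | prop (p : AP)
  | eps | neg | or | next | untl | trig | plus | comp | star
  deriving DecidableEq

/-- `x k lab`: node `k` has label `lab`; `l k m`, `r k m`: node `m` is the left, right child of
node `k`; `a k`: node `k` has the type of an atomic expression;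
`y w i k`: the suffix of `w` from `i` satisfies the formula at node `k`;
`z w i j k`: the infix `[i, j)` of `w` matches the regular expression at node `k`. -/
inductive Var (AP : Type*) where
  | x (k : ℕ) (lab : Label AP)
  | l (k m : ℕ)
  | r (k m : ℕ)
  | a (k : ℕ)
  | y (w : UPWord AP) (i k : ℕ)
  | z (w : UPWord AP) (i j k : ℕ)

noncomputable section Encoding

open PropForm

variable {AP : Type*} [Fintype AP] [DecidableEq AP]

abbrev x (k : ℕ) (lab : Label AP) : PropForm (Var AP) := .var (.x k lab)
abbrev l (k m : ℕ) : PropForm (Var AP) := .var (.l k m)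
abbrev r (k m : ℕ) : PropForm (Var AP) := .var (.r k m)
abbrev a (k : ℕ) : PropForm (Var AP) := .var (.a k)
abbrev y (w : UPWord AP) (i k : ℕ) : PropForm (Var AP) := .var (.y w i k)
abbrev z (w : UPWord AP) (i j k : ℕ) : PropForm (Var AP) := .var (.z w i j k)

/-- The atomic propositions, as a list. -/
def props (AP : Type*) [Fintype AP] : List AP := Finset.univ.toList

/-- Labels of atomic expressions. -/
def labA (AP : Type*) [Fintype AP] : List (Label AP) :=
  [.neg, .or] ++ (props AP).map .prop

/-- Labels of regular expressions. -/
def labR (AP : Type*) [Fintype AP] : List (Label AP) :=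
  [.eps, .plus, .comp, .star] ++ labA AP

/-- Labels of PSL formulas. -/
def labF (AP : Type*) [Fintype AP] : List (Label AP) :=
  [.next, .untl, .trig] ++ labA AP

/-- All labels. -/
def labAll (AP : Type*) [Fintype AP] : List (Label AP) :=
  [.next, .untl, .trig] ++ labR AP

/-- Node `k` carries a label from the list `L`. -/
def hasLab (L : List (Label AP)) (k : ℕ) : PropForm (Var AP) := bigOr L fun c => x k c

/-! #### Structural constraints -/

/-- Every node has exactly one label. -/
def strLabel (n : ℕ) : PropForm (Var AP) :=
  and (bigAnd (List.Ico 1 (n + 1)) fun k => bigOr (labAll AP) fun c => x k c)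
    (bigAnd (List.Ico 1 (n + 1)) fun k => bigAnd (labAll AP) fun c => bigAnd (labAll AP) fun d =>
      if c ≠ d then or (neg (x k c)) (neg (x k d)) else tt)

/-- Every node `k ≥ 2` has exactly one left child, and it is smaller than `k`. -/
def strLeft (n : ℕ) : PropForm (Var AP) :=
  and (bigAnd (List.Ico 2 (n + 1)) fun k => bigOr (List.Ico 1 k) fun m => l k m)
    (bigAnd (List.Ico 2 (n + 1)) fun k => bigAnd (List.Ico 1 k) fun m =>
      bigAnd (List.Ico (m + 1) k) fun m' => or (neg (l k m)) (neg (l k m')))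

/-- Every node `k ≥ 2` has exactly one right child, and it is smaller than `k`. -/
def strRight (n : ℕ) : PropForm (Var AP) :=
  and (bigAnd (List.Ico 2 (n + 1)) fun k => bigOr (List.Ico 1 k) fun m => r k m)
    (bigAnd (List.Ico 2 (n + 1)) fun k => bigAnd (List.Ico 1 k) fun m =>
      bigAnd (List.Ico (m + 1) k) fun m' => or (neg (r k m)) (neg (r k m')))

/-- Nodes `k ≥ 2` with a label in `L` have a left child with label in `LL` and a right child
with label in `LR`. -/
def strOrder (n : ℕ) (L LL LR : List (Label AP)) : PropForm (Var AP) :=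
  bigAnd (List.Ico 2 (n + 1)) fun k => bigAnd (List.Ico 1 k) fun m => bigAnd (List.Ico 1 k) fun m' =>
    bigAnd L fun c =>
      imp (and (x k c) (and (l k m) (r k m'))) (and (hasLab LL m) (hasLab LR m'))

/-- Typing of `¬` and `∨` inside regular expressions: where a regular expression is required,
a node with label `¬` or `∨` is of atomic type, and below a node of atomic type there are only
`¬`, `∨` and propositions. -/
def strAtomic (n : ℕ) : PropForm (Var AP) :=
  all [
    bigAnd (List.Ico 1 (n + 1)) fun k => imp (a k) (hasLab (labA AP) k),
    bigAnd (List.Ico 2 (n + 1)) fun k => bigAnd (List.Ico 1 k) fun m =>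
      bigAnd [Label.neg, Label.or] fun c => imp (and (a k) (and (x k c) (l k m))) (a m),
    bigAnd (List.Ico 2 (n + 1)) fun k => bigAnd (List.Ico 1 k) fun m =>
      imp (and (a k) (and (x k .or) (r k m))) (a m),
    bigAnd (List.Ico 2 (n + 1)) fun k => bigAnd (List.Ico 1 k) fun m =>
      bigAnd [Label.plus, Label.comp, Label.star, Label.trig] fun c =>
        imp (and (x k c) (l k m)) (imp (or (x m .neg) (x m .or)) (a m)),
    bigAnd (List.Ico 2 (n + 1)) fun k => bigAnd (List.Ico 1 k) fun m =>
      bigAnd [Label.plus, Label.comp] fun c =>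
        imp (and (x k c) (r k m)) (imp (or (x m .neg) (x m .or)) (a m))]

/-- Node `1` is a leaf, and the root `n` is a PSL formula. -/
def strEnds (n : ℕ) : PropForm (Var AP) :=
  and (or (x 1 .eps) (bigOr (props AP) fun p => x 1 (.prop p))) (hasLab (labF AP) n)

/-- `Φ_n^str` -/
def PhiStr (n : ℕ) : PropForm (Var AP) :=
  all [strLabel n, strLeft n, strRight n,
    strOrder n [.plus, .star, .comp] (labR AP) (labR AP),
    strOrder n [.next, .untl, .neg, .or] (labF AP) (labF AP),
    strOrder n [.trig] (labR AP) (labF AP),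
    strAtomic n, strEnds n]

/-! #### Constraints for regular expressions -/

/-- `⋀_{0 ≤ i ≤ j ≤ B} f i j` -/
def infixes (B : ℕ) (f : ℕ → ℕ → PropForm (Var AP)) : PropForm (Var AP) :=
  bigAnd (List.Ico 0 (B + 1)) fun i => bigAnd (List.Ico i (B + 1)) fun j => f i j

/-- `⋀_k [x_{k,c} → f k]` -/
def forLeaf (n : ℕ) (c : Label AP) (f : ℕ → PropForm (Var AP)) : PropForm (Var AP) :=
  bigAnd (List.Ico 1 (n + 1)) fun k => imp (x k c) (f k)

/-- `⋀_{k, m < k} [x_{k,c} ∧ l_{k,m} → f k m]` -/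
def forUn (n : ℕ) (c : Label AP) (f : ℕ → ℕ → PropForm (Var AP)) : PropForm (Var AP) :=
  bigAnd (List.Ico 1 (n + 1)) fun k => bigAnd (List.Ico 1 k) fun m =>
    imp (and (x k c) (l k m)) (f k m)

/-- `⋀_{k, m < k, m' < k} [x_{k,c} ∧ l_{k,m} ∧ r_{k,m'} → f k m m']` -/
def forBin (n : ℕ) (c : Label AP) (f : ℕ → ℕ → ℕ → PropForm (Var AP)) : PropForm (Var AP) :=
  bigAnd (List.Ico 1 (n + 1)) fun k => bigAnd (List.Ico 1 k) fun m => bigAnd (List.Ico 1 k) fun m' =>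
    imp (and (x k c) (and (l k m) (r k m'))) (f k m m')

/-- The constraints that fix the variables `z`; `B = |u v^b|`. -/
def PhiReg (n : ℕ) (w : UPWord AP) (B : ℕ) : PropForm (Var AP) :=
  all [
    forLeaf n .eps fun k => infixes B fun i j => iff (z w i j k) (const (i = j)),
    bigAnd (props AP) fun p => forLeaf n (.prop p) fun k => infixes B fun i j =>
      iff (z w i j k) (const (j = i + 1 ∧ p ∈ w.word i)),
    forUn n .neg fun k m => infixes B fun i j =>
      iff (z w i j k) (and (const (j = i + 1)) (neg (z w i j m))),
    forBin n .or fun k m m' => infixes B fun i j =>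
      iff (z w i j k) (or (z w i j m) (z w i j m')),
    forBin n .plus fun k m m' => infixes B fun i j =>
      iff (z w i j k) (or (z w i j m) (z w i j m')),
    forBin n .comp fun k m m' => infixes B fun i j =>
      iff (z w i j k) (bigOr (List.Ico i (j + 1)) fun t => and (z w i t m) (z w t j m')),
    forUn n .star fun k m => infixes B fun i j =>
      iff (z w i j k) (or (const (i = j))
        (bigOr (List.Ico (i + 1) (j + 1)) fun t => and (z w i t m) (z w t j k)))]

/-! #### Constraints for the LTL operators and the triggers operator -/

/-- The positions between `i` and `j` in the loop, where `|u| ≤ i, j < |uv|`. -/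
def between (w : UPWord AP) (i j : ℕ) : List ℕ :=
  if i ≤ j then List.Ico i j else List.Ico w.lu j ++ List.Ico i w.luv

/-- The constraints that fix the variables `y`; `B = |u v^b|`. -/
def PhiLTL (n : ℕ) (w : UPWord AP) (B : ℕ) : PropForm (Var AP) :=
  all [
    bigAnd (props AP) fun p => forLeaf n (.prop p) fun k => bigAnd (List.Ico 0 w.luv) fun i =>
      if p ∈ w.word i then y w i k else neg (y w i k),
    forUn n .neg fun k m => bigAnd (List.Ico 0 w.luv) fun i => iff (y w i k) (neg (y w i m)),
    forBin n .or fun k m m' => bigAnd (List.Ico 0 w.luv) fun i =>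
      iff (y w i k) (or (y w i m) (y w i m')),
    forUn n .next fun k m =>
      and (bigAnd (List.Ico 0 (w.luv - 1)) fun i => iff (y w i k) (y w (i + 1) m))
        (iff (y w (w.luv - 1) k) (y w w.lu m)),
    forBin n .untl fun k m m' =>
      and
        (bigAnd (List.Ico 0 w.lu) fun i => iff (y w i k)
          (bigOr (List.Ico i w.luv) fun j =>
            and (y w j m') (bigAnd (List.Ico i j) fun t => y w t m)))
        (bigAnd (List.Ico w.lu w.luv) fun i => iff (y w i k)
          (bigOr (List.Ico w.lu w.luv) fun j =>
            and (y w j m') (bigAnd (between w i j) fun t => y w t m))),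
    forBin n .trig fun k m m' => bigAnd (List.Ico 0 w.luv) fun i => iff (y w i k)
      (bigAnd (List.Ico (i + 1) (B + 1)) fun j => imp (z w i j m) (y w (w.M (j - 1)) m'))]

/-- `Φ_n^{u,v}`, with `b = 2^n + 1` unrollings of `v`. -/
def PhiWord (n : ℕ) (w : UPWord AP) : PropForm (Var AP) :=
  and (PhiReg n w (w.luvb (2 ^ n + 1))) (PhiLTL n w (w.luvb (2 ^ n + 1)))

/-- `Φ_n^cst` -/
def PhiCst (S : Sample AP) (n : ℕ) : PropForm (Var AP) :=
  and (bigAnd S.P.toList fun w => and (PhiWord n w) (y w 0 n))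
    (bigAnd S.N.toList fun w => and (PhiWord n w) (neg (y w 0 n)))

/-- `Φ_n^S` -/
def Phi (S : Sample AP) (n : ℕ) : PropForm (Var AP) := and (PhiStr n) (PhiCst S n)

end Encoding

/-! ### Extraction of a formula from a model -/

/-- `Unravels v k t`: the labels and children given by the interpretation `v` unravel, from node
`k` on, to the syntax tree `t`. -/
inductive Unravels {AP : Type*} (v : Var AP → Bool) : ℕ → SynTree AP → Prop where
  | prop {k : ℕ} {p : AP} (hx : v (.x k (.prop p))) : Unravels v k (.prop p)
  | eps {k : ℕ} (hx : v (.x k .eps)) : Unravels v k .eps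
  | neg {k m : ℕ} {t : SynTree AP} (hx : v (.x k .neg))
      (hm : 1 ≤ m ∧ m < k) (hl : v (.l k m)) (h : Unravels v m t) : Unravels v k (.neg t)
  | next {k m : ℕ} {t : SynTree AP} (hx : v (.x k .next))
      (hm : 1 ≤ m ∧ m < k) (hl : v (.l k m)) (h : Unravels v m t) : Unravels v k (.next t)
  | star {k m : ℕ} {t : SynTree AP} (hx : v (.x k .star))
      (hm : 1 ≤ m ∧ m < k) (hl : v (.l k m)) (h : Unravels v m t) : Unravels v k (.star t)
  | or {k m m' : ℕ} {t t' : SynTree AP} (hx : v (.x k .or))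
      (hm : 1 ≤ m ∧ m < k) (hl : v (.l k m)) (h : Unravels v m t)
      (hm' : 1 ≤ m' ∧ m' < k) (hr : v (.r k m')) (h' : Unravels v m' t') :
      Unravels v k (.or t t')
  | untl {k m m' : ℕ} {t t' : SynTree AP} (hx : v (.x k .untl))
      (hm : 1 ≤ m ∧ m < k) (hl : v (.l k m)) (h : Unravels v m t)
      (hm' : 1 ≤ m' ∧ m' < k) (hr : v (.r k m')) (h' : Unravels v m' t') :
      Unravels v k (.untl t t')
  | trig {k m m' : ℕ} {t t' : SynTree AP} (hx : v (.x k .trig))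
      (hm : 1 ≤ m ∧ m < k) (hl : v (.l k m)) (h : Unravels v m t)
      (hm' : 1 ≤ m' ∧ m' < k) (hr : v (.r k m')) (h' : Unravels v m' t') :
      Unravels v k (.trig t t')
  | plus {k m m' : ℕ} {t t' : SynTree AP} (hx : v (.x k .plus))
      (hm : 1 ≤ m ∧ m < k) (hl : v (.l k m)) (h : Unravels v m t)
      (hm' : 1 ≤ m' ∧ m' < k) (hr : v (.r k m')) (h' : Unravels v m' t') :
      Unravels v k (.plus t t')
  | comp {k m m' : ℕ} {t t' : SynTree AP} (hx : v (.x k .comp))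
      (hm : 1 ≤ m ∧ m < k) (hl : v (.l k m)) (h : Unravels v m t)
      (hm' : 1 ≤ m' ∧ m' < k) (hr : v (.r k m')) (h' : Unravels v m' t') :
      Unravels v k (.comp t t')

/-- `φ` is the formula `φ_v` that is read off the interpretation `v` at the root `n`. -/
def Extracts {AP : Type*} (v : Var AP → Bool) (n : ℕ) (φ : PSL AP) : Prop := Unravels v n φ.tree

/-! ### The learning algorithm -/

/-- Configurations: the loop with counter value `n`; the loop left with a model `v` of `Φ_n^S`;
the result `φ` returned. -/
inductive Config (AP : Type*) where
  | loop (n : ℕ)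
  | solved (n : ℕ) (v : Var AP → Bool)
  | returned (φ : PSL AP)

/-- One step of the algorithm: increment the counter, construct `Φ` for the new counter value and
check its satisfiability; if it is unsatisfiable, stay in the loop, otherwise leave the loop
with some model `v` and then return `φ_v`. -/
inductive Step {AP : Type*} [Fintype AP] [DecidableEq AP] (S : Sample AP) :
    Config AP → Config AP → Prop where
  | unsat {n : ℕ} (h : ¬ (Phi S (n + 1)).Satisfiable) : Step S (.loop n) (.loop (n + 1))
  | sat {n : ℕ} {v : Var AP → Bool} (h : (Phi S (n + 1)).Holds v) :
      Step S (.loop n) (.solved (n + 1) v)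
  | ret {n : ℕ} {v : Var AP → Bool} {φ : PSL AP} (h : Extracts v n φ) :
      Step S (.solved n v) (.returned φ)

/-- `c` occurs in a run of the algorithm on the input `S`. -/
def Reachable {AP : Type*} [Fintype AP] [DecidableEq AP] (S : Sample AP) (c : Config AP) : Prop :=
  Relation.ReflTransGen (Step S) (.loop 0) c

end PSLLearning

/-! A model of the encoding is a numbered syntax DAG together with its semantics on finitely many
positions of each word, so the theorem rests on the claim that finitely many positions suffice.

For the LTL operators this is periodicity: from position |u| on, truth depends only on the position
modulo |v|, and `uv` can be read as a prefix followed by a loop. The triggers operator is harder,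
since its matches may be arbitrarily long. A match of [i, j) can be cut at any inner position, and
its two parts need to agree only on a state, essentially the place in the unfolded expression at
which the cut falls. An expression with at most n distinct subtrees has at most 2^n states
(`SynTree.exists_cutSystem`). If j lies beyond |uv^b| with b = 2^n + 1, then among 2^n + 1 cuts that
are congruent modulo |v| two share a state. Removing what lies between them gives a shorter match
whose end is congruent to j (`UPWord.exists_shorter_match`). So a trigger that fails somewhere
already fails within the bound (`UPWord.satAt_trig_iff`).

It follows that in every model the values of `z` and `y` at the nodes of the unravelled formula are
the true ones (`RegExpr.z_iff`, `PSL.y_iff`). The bound 2^n applies because distinct subtrees sit at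
distinct nodes (`Unravels.card_subtrees_le`). Conversely, numbering the subtrees of a consistent
formula by increasing size and setting all variables to their true values gives a model
(`satisfiable_of_consistent`). Models may leave nodes unused; replacing φ by φ ∨ φ pads a formula to
the exact size.

The algorithm stops because different words are separated by some formula X^i p or its negation, and
Boolean combinations of these are consistent with the sample. The result is minimal because all
smaller values of the counter gave unsatisfiable formulas. -/

namespace PSLLearning

/-! ### Evaluation of the propositional connectives -/

namespace PropForm

variable {V ι : Type*} {v : V → Bool}

@[simp] theorem holds_var (x : V) : Holds v (.var x) ↔ v x = true := Iff.rfl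
@[simp] theorem holds_ff : ¬ Holds v .ff := id
@[simp] theorem holds_neg (Φ : PropForm V) : Holds v (.neg Φ) ↔ ¬ Holds v Φ := Iff.rfl
@[simp] theorem holds_or (Φ Ψ : PropForm V) : Holds v (.or Φ Ψ) ↔ Holds v Φ ∨ Holds v Ψ := Iff.rfl
@[simp] theorem holds_tt : Holds v .tt := id

@[simp] theorem holds_and (Φ Ψ : PropForm V) : Holds v (.and Φ Ψ) ↔ Holds v Φ ∧ Holds v Ψ := by
  simp [PropForm.and]

@[simp] theorem holds_imp (Φ Ψ : PropForm V) : Holds v (.imp Φ Ψ) ↔ (Holds v Φ → Holds v Ψ) := by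
  simp [PropForm.imp, imp_iff_not_or]

@[simp] theorem holds_iff (Φ Ψ : PropForm V) : Holds v (.iff Φ Ψ) ↔ (Holds v Φ ↔ Holds v Ψ) := by
  simp [PropForm.iff, iff_def]

@[simp] theorem holds_const (c : Prop) [Decidable c] : Holds v (const c) ↔ c := by
  by_cases h : c <;> simp [const, h]

@[simp] theorem holds_all (L : List (PropForm V)) : Holds v (all L) ↔ ∀ Φ ∈ L, Holds v Φ := by
  induction L with
  | nil => simp [all]
  | cons Φ L ih =>
    have : all (Φ :: L) = and Φ (all L) := rfl
    simp [this, ih]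

@[simp] theorem holds_any (L : List (PropForm V)) : Holds v (any L) ↔ ∃ Φ ∈ L, Holds v Φ := by
  induction L with
  | nil => simp [any]
  | cons Φ L ih =>
    have : any (Φ :: L) = or Φ (any L) := rfl
    simp [this, ih]

@[simp] theorem holds_bigAnd (L : List ι) (f : ι → PropForm V) :
    Holds v (bigAnd L f) ↔ ∀ i ∈ L, Holds v (f i) := by simp [bigAnd]

@[simp] theorem holds_bigOr (L : List ι) (f : ι → PropForm V) :
    Holds v (bigOr L f) ↔ ∃ i ∈ L, Holds v (f i) := by simp [bigOr]

@[simp] theorem holds_ite (c : Prop) [Decidable c] (Φ Ψ : PropForm V) :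
    Holds v (if c then Φ else Ψ) ↔ if c then Holds v Φ else Holds v Ψ := by
  split <;> rfl

end PropForm

/-! ### Membership in the label sets. -/

section Labels

variable {AP : Type*} [Fintype AP]

@[simp] theorem mem_props (p : AP) : p ∈ props AP := by simp [props]

theorem mem_labA {c : Label AP} : c ∈ labA AP ↔ c = .neg ∨ c = .or ∨ ∃ p, c = .prop p := by
  simp [labA, eq_comm]

theorem mem_labR {c : Label AP} : c ∈ labR AP ↔
    c = .eps ∨ c = .plus ∨ c = .comp ∨ c = .star ∨ c = .neg ∨ c = .or ∨ ∃ p, c = .prop p := by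
  simp [labR, mem_labA]

theorem mem_labF {c : Label AP} : c ∈ labF AP ↔
    c = .next ∨ c = .untl ∨ c = .trig ∨ c = .neg ∨ c = .or ∨ ∃ p, c = .prop p := by
  simp [labF, mem_labA]

@[simp] theorem mem_labAll (c : Label AP) : c ∈ labAll AP := by
  cases c <;> simp [labAll, mem_labR]

end Labels

open PropForm

/-! ### The structural constraints as statements about an interpretation. -/

section Constraints

variable {AP : Type*} {v : Var AP → Bool}

@[simp] theorem holds_hasLab (L : List (Label AP)) (k : ℕ) :
    (hasLab L k).Holds v ↔ ∃ c ∈ L, v (.x k c) = true := by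
  simp [hasLab]

@[simp] theorem holds_infixes (B : ℕ) (f : ℕ → ℕ → PropForm (Var AP)) :
    (infixes B f).Holds v ↔ ∀ i j, i ≤ j → j ≤ B → (f i j).Holds v := by
  simp only [infixes, holds_bigAnd, List.Ico.mem]
  exact ⟨fun h i j hij hj => h i (by omega) j (by omega), fun h i hi j hj => h i j hj.1 (by omega)⟩

@[simp] theorem holds_forLeaf (n : ℕ) (c : Label AP) (f : ℕ → PropForm (Var AP)) :
    (forLeaf n c f).Holds v ↔ ∀ k, 1 ≤ k → k ≤ n → v (.x k c) = true → (f k).Holds v := by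
  simp [forLeaf]

@[simp] theorem holds_forUn (n : ℕ) (c : Label AP) (f : ℕ → ℕ → PropForm (Var AP)) :
    (forUn n c f).Holds v ↔ ∀ k, k ≤ n → ∀ m, 1 ≤ m → m < k → v (.x k c) = true →
      v (.l k m) = true → (f k m).Holds v := by
  simp only [forUn, holds_bigAnd, List.Ico.mem, holds_imp, holds_and, holds_var]
  exact ⟨fun h k hk m hm hmk hx hl => h k (by omega) m ⟨hm, hmk⟩ ⟨hx, hl⟩,
    fun h k hk m hm hx => h k (by omega) m hm.1 hm.2 hx.1 hx.2⟩

@[simp] theorem holds_forBin (n : ℕ) (c : Label AP) (f : ℕ → ℕ → ℕ → PropForm (Var AP)) :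
    (forBin n c f).Holds v ↔ ∀ k, k ≤ n → ∀ m, 1 ≤ m → m < k → ∀ m', 1 ≤ m' → m' < k →
      v (.x k c) = true → v (.l k m) = true → v (.r k m') = true → (f k m m').Holds v := by
  simp only [forBin, holds_bigAnd, List.Ico.mem, holds_imp, holds_and, holds_var]
  exact ⟨fun h k hk m hm hmk m' hm' hmk' hx hl hr =>
      h k (by omega) m ⟨hm, hmk⟩ m' ⟨hm', hmk'⟩ ⟨hx, hl, hr⟩,
    fun h k hk m hm m' hm' hx => h k (by omega) m hm.1 hm.2 m' hm'.1 hm'.2 hx.1 hx.2.1 hx.2.2⟩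

@[simp] theorem holds_strOrder (n : ℕ) (L LL LR : List (Label AP)) :
    (strOrder n L LL LR).Holds v ↔ ∀ k, k ≤ n → ∀ m, 1 ≤ m → m < k → ∀ m', 1 ≤ m' → m' < k →
      ∀ c ∈ L, v (.x k c) = true → v (.l k m) = true → v (.r k m') = true →
        (∃ d ∈ LL, v (.x m d) = true) ∧ ∃ d ∈ LR, v (.x m' d) = true := by
  simp only [strOrder, holds_bigAnd, List.Ico.mem, holds_imp, holds_and, holds_var, holds_hasLab]
  exact ⟨fun h k hk m hm hmk m' hm' hmk' c hc hx hl hr =>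
      h k (by omega) m ⟨hm, hmk⟩ m' ⟨hm', hmk'⟩ c hc ⟨hx, hl, hr⟩,
    fun h k hk m hm m' hm' c hc hx =>
      h k (by omega) m hm.1 hm.2 m' hm'.1 hm'.2 c hc hx.1 hx.2.1 hx.2.2⟩

theorem holds_strLabel [Fintype AP] [DecidableEq AP] (n : ℕ) : (strLabel n).Holds v ↔
    (∀ k, 1 ≤ k → k ≤ n → ∃ c, v (.x k c) = true) ∧
      ∀ k, 1 ≤ k → k ≤ n → ∀ c d, v (.x k c) = true → v (.x k d) = true → c = d := by
  simp only [strLabel, holds_and, holds_bigAnd, holds_bigOr, List.Ico.mem, mem_labAll, true_and,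
    holds_var, holds_ite, holds_or, holds_neg, true_imp_iff, Nat.lt_succ_iff, and_imp]
  refine and_congr Iff.rfl (forall₃_congr fun k _ _ => forall₂_congr fun c d => ?_)
  by_cases h : c = d <;> simp [h]
  grind

/-- The constraints on left and right children differ only in the edge variable `e`, and both unfold
to this formula. -/
theorem holds_unique_child_iff (n : ℕ) (e : ℕ → ℕ → PropForm (Var AP)) :
    (PropForm.and (bigAnd (List.Ico 2 (n + 1)) fun k => bigOr (List.Ico 1 k) fun m => e k m)
    (bigAnd (List.Ico 2 (n + 1)) fun k => bigAnd (List.Ico 1 k) fun m =>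
      bigAnd (List.Ico (m + 1) k) fun m' => .or (.neg (e k m)) (.neg (e k m')))).Holds v ↔
    ∀ k, 2 ≤ k → k ≤ n → ∃ m, (1 ≤ m ∧ m < k ∧ (e k m).Holds v) ∧
      ∀ m', 1 ≤ m' → m' < k → (e k m').Holds v → m' = m := by
  simp only [holds_and, holds_bigAnd, holds_bigOr, List.Ico.mem, holds_or, holds_neg]
  constructor
  · rintro ⟨h₁, h₂⟩ k hk hkn
    obtain ⟨m, hm, hl⟩ := h₁ k (by omega)
    refine ⟨m, ⟨hm.1, hm.2, hl⟩, fun m' h1 h2 h3 => ?_⟩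
    rcases lt_trichotomy m m' with h | h | h
    · have := h₂ k (by omega) m hm m' (by omega); tauto
    · exact h.symm
    · have := h₂ k (by omega) m' ⟨h1, h2⟩ m (by omega); tauto
  · intro h
    refine ⟨fun k hk => ?_, fun k hk m hm m' hm' => ?_⟩
    · obtain ⟨m, hm, -⟩ := h k (by omega) (by omega)
      exact ⟨m, ⟨hm.1, hm.2.1⟩, hm.2.2⟩
    · obtain ⟨m₀, -, hu⟩ := h k (by omega) (by omega)
      by_contra hc
      push Not at hc
      have h1 := hu m hm.1 hm.2 hc.1
      have h2 := hu m' (by omega) (by omega) hc.2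
      omega

theorem holds_strLeft (n : ℕ) : (strLeft n).Holds v ↔
    ∀ k, 2 ≤ k → k ≤ n → ∃ m, (1 ≤ m ∧ m < k ∧ v (.l k m) = true) ∧
      ∀ m', 1 ≤ m' → m' < k → v (.l k m') = true → m' = m :=
  holds_unique_child_iff n l

theorem holds_strRight (n : ℕ) : (strRight n).Holds v ↔
    ∀ k, 2 ≤ k → k ≤ n → ∃ m, (1 ≤ m ∧ m < k ∧ v (.r k m) = true) ∧
      ∀ m', 1 ≤ m' → m' < k → v (.r k m') = true → m' = m :=
  holds_unique_child_iff n r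

theorem holds_strAtomic [Fintype AP] (n : ℕ) : (strAtomic n).Holds v ↔
    (∀ k, 1 ≤ k → k ≤ n → v (.a k) = true → ∃ c ∈ labA AP, v (.x k c) = true) ∧
    (∀ k, k ≤ n → ∀ m, 1 ≤ m → m < k → ∀ c, c = .neg ∨ c = .or →
      v (.a k) = true → v (.x k c) = true → v (.l k m) = true → v (.a m) = true) ∧
    (∀ k, k ≤ n → ∀ m, 1 ≤ m → m < k →
      v (.a k) = true → v (.x k .or) = true → v (.r k m) = true → v (.a m) = true) ∧
    (∀ k, k ≤ n → ∀ m, 1 ≤ m → m < k → ∀ c, c = .plus ∨ c = .comp ∨ c = .star ∨ c = .trig →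
      v (.x k c) = true → v (.l k m) = true → (v (.x m .neg) = true ∨ v (.x m .or) = true) →
      v (.a m) = true) ∧
    (∀ k, k ≤ n → ∀ m, 1 ≤ m → m < k → ∀ c, c = .plus ∨ c = .comp →
      v (.x k c) = true → v (.r k m) = true → (v (.x m .neg) = true ∨ v (.x m .or) = true) →
      v (.a m) = true) := by
  simp only [strAtomic, holds_all, List.forall_mem_cons, List.not_mem_nil, false_imp_iff,
    implies_true, and_true]
  simp only [holds_bigAnd, List.Ico.mem, holds_imp, holds_and, holds_var, holds_hasLab, holds_or,
    List.not_mem_nil, List.mem_cons, or_false, Nat.lt_succ_iff]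
  refine and_congr (by grind) (and_congr (by grind) (and_congr (by grind) (and_congr ?_ ?_))) <;>
  exact ⟨fun h k hk m hm hmk c hc hx hl => h k (by omega) m ⟨hm, hmk⟩ c hc ⟨hx, hl⟩,
    fun h k hk m hm c hc hx => h k hk.2 m hm.1 hm.2 c hc hx.1 hx.2⟩

theorem holds_strEnds [Fintype AP] (n : ℕ) : (strEnds n).Holds v ↔
    (v (.x 1 .eps) = true ∨ ∃ p, v (.x 1 (.prop p)) = true) ∧
      ∃ c ∈ labF AP, v (.x n c) = true := by
  simp [strEnds]

theorem holds_PhiStr [Fintype AP] [DecidableEq AP] (n : ℕ) : (PhiStr n).Holds v ↔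
    (strLabel n).Holds v ∧ (strLeft n).Holds v ∧ (strRight n).Holds v ∧
    (strOrder n [.plus, .star, .comp] (labR AP) (labR AP)).Holds v ∧
    (strOrder n [.next, .untl, .neg, .or] (labF AP) (labF AP)).Holds v ∧
    (strOrder n [.trig] (labR AP) (labF AP)).Holds v ∧
    (strAtomic n).Holds v ∧ (strEnds n).Holds v := by
  simp only [PhiStr, holds_all, List.forall_mem_cons, List.not_mem_nil, false_imp_iff,
    implies_true, and_true]

end Constraints

/-! ### Semantics of syntax trees -/

section Semantics

variable {AP : Type*}

/-- Matching of the infix `[i, j)` of `α` against a syntax tree; trees that are not regular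
expressions are given a meaning, too. -/
def SynTree.Matches (α : InfWord AP) : SynTree AP → ℕ → ℕ → Prop
  | .prop p, i, j => j = i + 1 ∧ p ∈ α i
  | .eps, i, j => i = j
  | .neg t, i, j => j = i + 1 ∧ ¬ t.Matches α i j
  | .or t₁ t₂, i, j => t₁.Matches α i j ∨ t₂.Matches α i j
  | .plus t₁ t₂, i, j => t₁.Matches α i j ∨ t₂.Matches α i j
  | .comp t₁ t₂, i, j => ∃ k, i ≤ k ∧ k ≤ j ∧ t₁.Matches α i k ∧ t₂.Matches α k j
  | .star t, i, j => StarMatch (t.Matches α) i j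
  | .next _, _, _ => False
  | .untl _ _, _, _ => False
  | .trig _ _, _, _ => False

/-- Satisfaction of a syntax tree by the suffix of `α` from position `i`; trees that are not
formulas are given a meaning, too. -/
def SynTree.SatAt (α : InfWord AP) : SynTree AP → ℕ → Prop
  | .prop p, i => p ∈ α i
  | .eps, _ => False
  | .neg t, i => ¬ t.SatAt α i
  | .or t₁ t₂, i => t₁.SatAt α i ∨ t₂.SatAt α i
  | .plus _ _, _ => False
  | .comp _ _, _ => False
  | .star _, _ => False
  | .next t, i => t.SatAt α (i + 1)
  | .untl t₁ t₂, i => ∃ j, i ≤ j ∧ t₂.SatAt α j ∧ ∀ k, i ≤ k → k < j → t₁.SatAt α k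
  | .trig t₁ t₂, i => ∀ j, i < j → t₁.Matches α i j → t₂.SatAt α (j - 1)

theorem StarMatch.le {R : ℕ → ℕ → Prop} {i j : ℕ} (h : StarMatch R i j) : i ≤ j := by
  cases h <;> omega

theorem StarMatch.trans {R : ℕ → ℕ → Prop} {i j k : ℕ} (h : StarMatch R i j)
    (h' : StarMatch R j k) : StarMatch R i k := by
  induction h with
  | refl => exact h'
  | step hik hkj hR _ ih => exact .step hik (hkj.trans h'.le) hR (ih h')

theorem starMatch_iff {R : ℕ → ℕ → Prop} {i j : ℕ} :
    StarMatch R i j ↔ i = j ∨ ∃ k, i < k ∧ k ≤ j ∧ R i k ∧ StarMatch R k j := by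
  constructor
  · rintro (_ | ⟨h₁, h₂, h₃, h₄⟩)
    · exact .inl rfl
    · exact .inr ⟨_, h₁, h₂, h₃, h₄⟩
  · rintro (rfl | ⟨k, h₁, h₂, h₃, h₄⟩)
    · exact .refl _
    · exact .step h₁ h₂ h₃ h₄

/-- The piece of a decomposition that ends at or after an inner cut and begins before it. -/
theorem StarMatch.exists_piece {R : ℕ → ℕ → Prop} {i s j : ℕ} (h : StarMatch R i j) (his : i < s)
    (hsj : s ≤ j) : ∃ k k', i ≤ k ∧ k < s ∧ s ≤ k' ∧ k' ≤ j ∧ StarMatch R i k ∧ R k k' ∧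
      StarMatch R k' j := by
  induction h with
  | refl => omega
  | @step i m j him hmj hR h' ih =>
    by_cases hs : s ≤ m
    · exact ⟨i, m, le_rfl, his, hs, hmj, .refl _, hR, h'⟩
    · obtain ⟨k, k', h₁, h₂, h₃, h₄, h₅, h₆, h₇⟩ := ih (by omega) hsj
      exact ⟨k, k', by omega, h₂, h₃, h₄, .step him h₁ hR h₅, h₆, h₇⟩

/-- Two offsets let one induction serve both directions: `d = 0` removes a shift by `c`, and `c = 0`
adds one by `d`. Later pieces start further right, so the bound `L` persists. -/
theorem StarMatch.map_add {R R' : ℕ → ℕ → Prop} {c d L : ℕ}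
    (hR : ∀ i j, L ≤ i → R (i + c) (j + c) → R' (i + d) (j + d)) {i j : ℕ} (hi : L ≤ i)
    (h : StarMatch R (i + c) (j + c)) : StarMatch R' (i + d) (j + d) := by
  generalize hx : i + c = x at h
  generalize hy : j + c = y at h
  induction h generalizing i with
  | refl => obtain rfl : i = j := by omega
            exact .refl _
  | @step a k b hik hkj h₁ _ ih =>
    have : k = (k - c) + c := by omega
    refine .step (k := k - c + d) (by omega) (by omega) (hR _ _ hi ?_) (ih (by omega) this.symm hy)
    rwa [← this, hx]

/-! ### Invariance under periods of the word. -/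

section Periodic

variable {α : InfWord AP} {L d : ℕ}

/-- A match that starts at `i ≥ L` reads only letters from `i` on, and these do not change under the
shift by `d`. -/
theorem SynTree.matches_add (hα : ∀ i, L ≤ i → α (i + d) = α i) (t : SynTree AP) {i j : ℕ}
    (hi : L ≤ i) : t.Matches α (i + d) (j + d) ↔ t.Matches α i j := by
  induction t generalizing i j with
  | prop p =>
    simp only [Matches, hα i hi]
    exact and_congr (by omega) Iff.rfl
  | eps => simp [Matches]
  | neg t ih =>
    simp only [Matches, ih hi]
    exact and_congr (by omega) Iff.rfl
  | or t₁ t₂ ih₁ ih₂ => simp only [Matches, ih₁ hi, ih₂ hi]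
  | plus t₁ t₂ ih₁ ih₂ => simp only [Matches, ih₁ hi, ih₂ hi]
  | comp t₁ t₂ ih₁ ih₂ =>
    simp only [Matches]
    constructor
    · rintro ⟨k, h₁, h₂, h₃, h₄⟩
      obtain ⟨k, rfl⟩ : ∃ k', k = k' + d := ⟨k - d, by omega⟩
      exact ⟨k, by omega, by omega, (ih₁ hi).1 h₃, (ih₂ (by omega)).1 h₄⟩
    · rintro ⟨k, h₁, h₂, h₃, h₄⟩
      exact ⟨k + d, by omega, by omega, (ih₁ hi).2 h₃, (ih₂ (by omega)).2 h₄⟩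
  | star t ih =>
    simp only [Matches]
    exact ⟨fun h => StarMatch.map_add (d := 0) (fun i j hi => (ih hi).1) hi h,
      fun h => StarMatch.map_add (c := 0) (fun i j hi => (ih hi).2) hi h⟩
  | next => simp [Matches]
  | untl => simp [Matches]
  | trig => simp [Matches]

theorem SynTree.satAt_add (hα : ∀ i, L ≤ i → α (i + d) = α i) (t : SynTree AP) {i : ℕ}
    (hi : L ≤ i) : t.SatAt α (i + d) ↔ t.SatAt α i := by
  induction t generalizing i with
  | prop p => simp only [SatAt, hα i hi]
  | neg t ih => simp only [SatAt, ih hi]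
  | or t₁ t₂ ih₁ ih₂ => simp only [SatAt, ih₁ hi, ih₂ hi]
  | next t ih => simp only [SatAt, ← ih (i := i + 1) (by omega), Nat.add_right_comm]
  | untl t₁ t₂ ih₁ ih₂ =>
    simp only [SatAt]
    constructor
    · rintro ⟨j, h₁, h₂, h₃⟩
      obtain ⟨j, rfl⟩ : ∃ k', j = k' + d := ⟨j - d, by omega⟩
      exact ⟨j, by omega, (ih₂ (by omega)).1 h₂,
        fun k hk hkj => (ih₁ (by omega)).1 (h₃ _ (by omega) (by omega))⟩
    · rintro ⟨j, h₁, h₂, h₃⟩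
      refine ⟨j + d, by omega, (ih₂ (by omega)).2 h₂, fun k hk hkj => ?_⟩
      obtain ⟨k, rfl⟩ : ∃ k', k = k' + d := ⟨k - d, by omega⟩
      exact (ih₁ (by omega)).2 (h₃ _ (by omega) (by omega))
  | trig t₁ t₂ ih₁ ih₂ =>
    simp only [SatAt]
    constructor
    · intro h j hij hm
      have := h (j + d) (by omega) ((t₁.matches_add hα hi).2 hm)
      rwa [show j + d - 1 = j - 1 + d by omega, ih₂ (by omega)] at this
    · intro h j hij hm
      obtain ⟨j, rfl⟩ : ∃ k', j = k' + d := ⟨j - d, by omega⟩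
      rw [show j + d - 1 = j - 1 + d by omega, ih₂ (by omega)]
      exact h j (by omega) ((t₁.matches_add hα hi).1 hm)
  | _ => simp [SatAt]

end Periodic

/-! ### Agreement with the semantics of PSL -/

/-- In the clause for negation the conjunct `j = i + 1` keeps the complement among one-letter words.
-/
theorem AtomExpr.matches_tree (α : InfWord AP) (ξ : AtomExpr AP) (i j : ℕ) :
    ξ.tree.Matches α i j ↔ j = i + 1 ∧ α i ∈ ξ.sem := by
  induction ξ with
  | prop p => rfl
  | neg ξ ih => simp only [tree, SynTree.Matches, ih, sem, Set.mem_compl_iff]; tauto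
  | or ξ₁ ξ₂ ih₁ ih₂ => simp only [tree, SynTree.Matches, ih₁, ih₂, sem, Set.mem_union]; tauto

theorem RegExpr.matches_tree (α : InfWord AP) (ρ : RegExpr AP) (n i j : ℕ) :
    ρ.tree.Matches α (i + n) (j + n) ↔ PSLLearning.Matches (α.suffix n) ρ i j := by
  induction ρ generalizing i j with
  | eps => simp [tree, SynTree.Matches, PSLLearning.Matches, eq_comm]
  | atom ξ =>
    simp only [tree, AtomExpr.matches_tree, PSLLearning.Matches, InfWord.suffix, add_comm n i]
    exact and_congr (by omega) Iff.rfl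
  | plus ρ₁ ρ₂ ih₁ ih₂ => simp only [tree, SynTree.Matches, PSLLearning.Matches, ih₁, ih₂]
  | comp ρ₁ ρ₂ ih₁ ih₂ =>
    simp only [tree, SynTree.Matches, PSLLearning.Matches]
    constructor
    · rintro ⟨k, h₁, h₂, h₃, h₄⟩
      obtain ⟨k, rfl⟩ : ∃ k', k = k' + n := ⟨k - n, by omega⟩
      exact ⟨k, by omega, by omega, (ih₁ _ _).1 h₃, (ih₂ _ _).1 h₄⟩
    · rintro ⟨k, h₁, h₂, h₃, h₄⟩
      exact ⟨k + n, by omega, by omega, (ih₁ _ _).2 h₃, (ih₂ _ _).2 h₄⟩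
  | star ρ ih =>
    simp only [tree, SynTree.Matches, PSLLearning.Matches]
    exact ⟨fun h => StarMatch.map_add (d := 0) (fun i j _ => (ih i j).1) (Nat.zero_le i) h,
      fun h => StarMatch.map_add (c := 0) (fun i j _ => (ih i j).2) (Nat.zero_le i) h⟩

theorem InfWord.suffix_suffix (α : InfWord AP) (i j : ℕ) :
    (α.suffix i).suffix j = α.suffix (i + j) := by
  funext k; simp [InfWord.suffix, add_assoc]

/-- `Sat` passes to suffixes and always looks at position 0, whereas `SatAt` keeps `α` and moves the
position, as the encoding does. -/
theorem PSL.satAt_tree (α : InfWord AP) (φ : PSL AP) (i : ℕ) :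
    φ.tree.SatAt α i ↔ Sat (α.suffix i) φ := by
  induction φ generalizing i with
  | prop p => rfl
  | neg φ ih => simp only [tree, SynTree.SatAt, Sat, ih]
  | or φ₁ φ₂ ih₁ ih₂ => simp only [tree, SynTree.SatAt, Sat, ih₁, ih₂]
  | next φ ih => simp only [tree, SynTree.SatAt, Sat, ih, InfWord.suffix_suffix]
  | untl φ₁ φ₂ ih₁ ih₂ =>
    simp only [tree, SynTree.SatAt, Sat, ih₁, ih₂, InfWord.suffix_suffix]
    constructor
    · rintro ⟨j, h₁, h₂, h₃⟩
      refine ⟨j - i, by rwa [Nat.add_sub_cancel' h₁], fun k hk => h₃ _ (by omega) (by omega)⟩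
    · rintro ⟨j, h₂, h₃⟩
      refine ⟨i + j, by omega, h₂, fun k hk hkj => ?_⟩
      have := h₃ (k - i) (by omega)
      rwa [Nat.add_sub_cancel' hk] at this
  | trig ρ φ ih =>
    simp only [tree, SynTree.SatAt, Sat, ih, InfWord.suffix_suffix, ← RegExpr.matches_tree]
    constructor
    · intro h j hj hm
      rw [zero_add] at hm
      rw [← Nat.add_sub_assoc hj, add_comm]
      exact h _ (by omega) hm
    · intro h j hj hm
      have := h (j - i) (by omega) (by rwa [zero_add, Nat.sub_add_cancel hj.le])
      rwa [show i + (j - i - 1) = j - 1 by omega] at this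

theorem PSL.satAt_tree_zero (α : InfWord AP) (φ : PSL AP) : φ.tree.SatAt α 0 ↔ Sat α φ := by
  rw [PSL.satAt_tree]
  have : α.suffix 0 = α := by funext k; simp [InfWord.suffix]
  rw [this]

end Semantics

/-! ### Subtrees -/

section Subtrees

variable {AP : Type*} [DecidableEq AP]

namespace SynTree

theorem self_mem_subtrees (t : SynTree AP) : t ∈ t.subtrees := by
  cases t <;> simp [subtrees]

theorem sizeOf_le_of_mem_subtrees {s t : SynTree AP} (h : s ∈ t.subtrees) :
    sizeOf s ≤ sizeOf t := by
  induction t <;> simp only [subtrees, Finset.mem_insert, Finset.mem_union,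
    Finset.mem_singleton] at h <;> grind

theorem eq_of_mem_subtrees_of_sizeOf_le {s t : SynTree AP} (h : s ∈ t.subtrees)
    (hs : sizeOf t ≤ sizeOf s) : s = t := by
  cases t <;> simp only [subtrees, Finset.mem_insert, Finset.mem_union,
    Finset.mem_singleton] at h <;>
    grind [→ sizeOf_le_of_mem_subtrees]

theorem subtrees_subset {s t : SynTree AP} (h : s ∈ t.subtrees) : s.subtrees ⊆ t.subtrees := by
  induction t <;> simp only [subtrees, Finset.mem_insert, Finset.mem_union,
    Finset.mem_singleton] at h ⊢ <;> grind [subtrees]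

/-- The whole tree is too large to be a subtree of a proper subtree. This strict drop pays for each
doubling of the number of states. -/
theorem card_subtrees_lt {s t : SynTree AP} (h : s ∈ t.subtrees) (hne : s ≠ t) :
    s.subtrees.card < t.subtrees.card := by
  refine Finset.card_lt_card (Finset.ssubset_iff_subset_ne.2 ⟨subtrees_subset h, fun he => hne ?_⟩)
  exact eq_of_mem_subtrees_of_sizeOf_le h
    (sizeOf_le_of_mem_subtrees (he ▸ t.self_mem_subtrees))

end SynTree

end Subtrees
/-! ### Cutting matches

A match of `[i, j)` can be cut at any inner position `s` into an initial part and a final part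
that communicate through one of few states. -/

section Cuts

variable {AP : Type*}

/-- `R i j` holds iff, for an arbitrary cut `i < s ≤ j`, some state `q` connects an initial part
`Pre i s q` with a final part `Post q s j`, and the final parts depend only on the word `α` from
`s` on, as far as periods of `α` after position `L` can tell. -/
structure CutSystem (α : InfWord AP) (L : ℕ) (R : ℕ → ℕ → Prop) (Q : Type) where
  Pre : ℕ → ℕ → Q → Prop
  Post : Q → ℕ → ℕ → Prop
  join : ∀ {i s j q}, i < s → s ≤ j → Pre i s q → Post q s j → R i j
  cut : ∀ {i s j}, i < s → s ≤ j → R i j → ∃ q, Pre i s q ∧ Post q s j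
  shift : ∀ {d}, (∀ i, L ≤ i → α (i + d) = α i) → ∀ {q s j}, L ≤ s →
    Post q (s + d) (j + d) → Post q s j

variable {α : InfWord AP} {L : ℕ} {R R₁ R₂ : ℕ → ℕ → Prop} {Q Q₁ Q₂ : Type}

namespace CutSystem

/-- A cut presupposes `i < j`. This serves `ε` and the trees that match nothing, and no state is
needed. -/
def ofNotLt (hR : ∀ i j, i < j → ¬ R i j) : CutSystem α L R Empty where
  Pre _ _ _ := False
  Post _ _ _ := False
  join _ _ h := h.elim
  cut h₁ h₂ h := (hR _ _ (h₁.trans_le h₂) h).elim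
  shift _ _ _ _ _ h := h

/-- In a one-letter match the only cut `i < s ≤ j` is `s = j`, so the final part is empty and one
state is enough. -/
def ofLetter (hR : ∀ i j, R i j → j = i + 1) : CutSystem α L R Unit where
  Pre i s _ := R i s
  Post _ s j := s = j
  join _ _ h h' := h' ▸ h
  cut {i s j} h₁ h₂ h := by
    obtain rfl : s = j := by have := hR _ _ h; omega
    exact ⟨(), h, rfl⟩
  shift _ _ _ _ _ h := by omega

def sup (C₁ : CutSystem α L R₁ Q₁) (C₂ : CutSystem α L R₂ Q₂) :
    CutSystem α L (fun i j => R₁ i j ∨ R₂ i j) (Q₁ ⊕ Q₂) where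
  Pre i s := Sum.elim (C₁.Pre i s) (C₂.Pre i s)
  Post q s j := Sum.elim (C₁.Post · s j) (C₂.Post · s j) q
  join {i s j q} h₁ h₂ h h' := by
    cases q with
    | inl q => exact .inl (C₁.join h₁ h₂ h h')
    | inr q => exact .inr (C₂.join h₁ h₂ h h')
  cut h₁ h₂ h := by
    rcases h with h | h
    · obtain ⟨q, hq⟩ := C₁.cut h₁ h₂ h
      exact ⟨.inl q, hq⟩
    · obtain ⟨q, hq⟩ := C₂.cut h₁ h₂ h
      exact ⟨.inr q, hq⟩
  shift {_} hd {q s j} hs h := by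
    cases q with
    | inl q => exact C₁.shift hd hs h
    | inr q => exact C₂.shift hd hs h

/-- The state tells which factor contains the cut; a cut on the border counts for the first. In that
case the final part includes a whole match of the second factor, so `shift` needs translation
invariance of `R₂`. -/
def comp (C₁ : CutSystem α L R₁ Q₁) (C₂ : CutSystem α L R₂ Q₂)
    (hR₂ : ∀ {d}, (∀ i, L ≤ i → α (i + d) = α i) → ∀ {i j}, L ≤ i →
      R₂ (i + d) (j + d) → R₂ i j) :
    CutSystem α L (fun i j => ∃ k, i ≤ k ∧ k ≤ j ∧ R₁ i k ∧ R₂ k j) (Q₁ ⊕ Q₂) where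
  Pre i s := Sum.elim (C₁.Pre i s) (fun q => ∃ k, i ≤ k ∧ k < s ∧ R₁ i k ∧ C₂.Pre k s q)
  Post q s j := Sum.elim (fun q => ∃ k, s ≤ k ∧ k ≤ j ∧ C₁.Post q s k ∧ R₂ k j)
    (C₂.Post · s j) q
  join {i s j q} h₁ h₂ h h' := by
    cases q with
    | inl q =>
      obtain ⟨k, hk, hkj, hp, hr⟩ := h'
      exact ⟨k, h₁.le.trans hk, hkj, C₁.join h₁ hk h hp, hr⟩
    | inr q =>
      obtain ⟨k, hk, hks, hr, hp⟩ := h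
      exact ⟨k, hk, hks.le.trans h₂, hr, C₂.join hks h₂ hp h'⟩
  cut {i s j} h₁ h₂ h := by
    obtain ⟨k, hik, hkj, hr₁, hr₂⟩ := h
    by_cases hk : s ≤ k
    · obtain ⟨q, hq, hq'⟩ := C₁.cut h₁ hk hr₁
      exact ⟨.inl q, hq, k, hk, hkj, hq', hr₂⟩
    · obtain ⟨q, hq, hq'⟩ := C₂.cut (not_le.1 hk) h₂ hr₂
      exact ⟨.inr q, ⟨k, hik, not_le.1 hk, hr₁, hq⟩, hq'⟩
  shift {d} hd {q s j} hs h := by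
    cases q with
    | inl q =>
      obtain ⟨k, hk, hkj, hp, hr⟩ := h
      obtain ⟨k, rfl⟩ : ∃ k', k = k' + d := ⟨k - d, by omega⟩
      exact ⟨k, by omega, by omega, C₁.shift hd hs hp, hR₂ hd (by omega) hr⟩
    | inr q => exact C₂.shift hd hs h

/-- Only the piece hit by the cut matters: complete pieces before it go into the initial part, those
after it into the final part. Iteration therefore adds no states. -/
def star (C : CutSystem α L R Q)
    (hR : ∀ {d}, (∀ i, L ≤ i → α (i + d) = α i) → ∀ {i j}, L ≤ i →
      R (i + d) (j + d) → R i j) :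
    CutSystem α L (StarMatch R) Q where
  Pre i s q := ∃ k, i ≤ k ∧ k < s ∧ StarMatch R i k ∧ C.Pre k s q
  Post q s j := ∃ k, s ≤ k ∧ k ≤ j ∧ C.Post q s k ∧ StarMatch R k j
  join := by
    rintro i s j q h₁ h₂ ⟨k, hik, hks, hr, hp⟩ ⟨k', hsk', hkj', hp', hr'⟩
    exact hr.trans (.step (hks.trans_le hsk') hkj' (C.join hks hsk' hp hp') hr')
  cut {i s j} h₁ h₂ h := by
    obtain ⟨k, k', hik, hks, hsk', hkj', hr, hR, hr'⟩ := h.exists_piece h₁ h₂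
    obtain ⟨q, hq, hq'⟩ := C.cut hks hsk' hR
    exact ⟨q, ⟨k, hik, hks, hr, hq⟩, k', hsk', hkj', hq', hr'⟩
  shift {d} hd {q s j} hs := by
    rintro ⟨k, hk, hkj, hp, hr⟩
    obtain ⟨k, rfl⟩ : ∃ k', k = k' + d := ⟨k - d, by omega⟩
    exact ⟨k, by omega, by omega, C.shift hd hs hp,
      StarMatch.map_add (d := 0) (fun i j hi => hR hd hi) (by omega) hr⟩

end CutSystem

/-- Binary operators add the numbers of states of their arguments. Since shared subtrees are counted
once, as in t ∘ t, the sum may double while the count of subtrees grows by one only; hence the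
exponential bound. -/
theorem SynTree.exists_cutSystem [DecidableEq AP] (α : InfWord AP) (L : ℕ) (t : SynTree AP) :
    ∃ (Q : Type) (_ : Fintype Q), Fintype.card Q ≤ 2 ^ t.subtrees.card ∧
      Nonempty (CutSystem α L (t.Matches α) Q) := by
  have card_sum {t₁ t₂ t : SynTree AP} (h₁ : t₁ ∈ t.subtrees) (h₂ : t₂ ∈ t.subtrees)
      (ne₁ : t₁ ≠ t) (ne₂ : t₂ ≠ t) {Q₁ Q₂ : Type} [Fintype Q₁] [Fintype Q₂]
      (c₁ : Fintype.card Q₁ ≤ 2 ^ t₁.subtrees.card) (c₂ : Fintype.card Q₂ ≤ 2 ^ t₂.subtrees.card) :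
      Fintype.card (Q₁ ⊕ Q₂) ≤ 2 ^ t.subtrees.card := by
    have hlt := card_subtrees_lt h₁ ne₁
    -- Both arguments have at most `c` subtrees, and 2^c + 2^c = 2^(c+1).
    obtain ⟨c, hc⟩ : ∃ c, t.subtrees.card = c + 1 := ⟨t.subtrees.card - 1, by omega⟩
    have e₁ : 2 ^ t₁.subtrees.card ≤ 2 ^ c := Nat.pow_le_pow_right (by norm_num) (by omega)
    have e₂ : 2 ^ t₂.subtrees.card ≤ 2 ^ c :=
      Nat.pow_le_pow_right (by norm_num) (by have := card_subtrees_lt h₂ ne₂; omega)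
    rw [Fintype.card_sum, hc, pow_succ]
    omega
  induction t with
  | eps => exact ⟨Empty, inferInstance, by simp, ⟨.ofNotLt fun i j h h' => by
      simp only [Matches] at h'; omega⟩⟩
  | next | untl | trig => exact ⟨Empty, inferInstance, by simp, ⟨.ofNotLt fun i j h h' => h'⟩⟩
  | prop | neg =>
    exact ⟨Unit, inferInstance, by simp [Nat.one_le_two_pow], ⟨.ofLetter fun i j h => h.1⟩⟩
  | or t₁ t₂ ih₁ ih₂ | plus t₁ t₂ ih₁ ih₂ =>
    obtain ⟨Q₁, _, c₁, ⟨C₁⟩⟩ := ih₁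
    obtain ⟨Q₂, _, c₂, ⟨C₂⟩⟩ := ih₂
    refine ⟨Q₁ ⊕ Q₂, inferInstance, card_sum ?_ ?_ ?_ ?_ c₁ c₂, ⟨C₁.sup C₂⟩⟩
    · simp [subtrees, self_mem_subtrees]
    · simp [subtrees, self_mem_subtrees]
    · intro h; have := congrArg sizeOf h; grind
    · intro h; have := congrArg sizeOf h; grind
  | comp t₁ t₂ ih₁ ih₂ =>
    obtain ⟨Q₁, _, c₁, ⟨C₁⟩⟩ := ih₁
    obtain ⟨Q₂, _, c₂, ⟨C₂⟩⟩ := ih₂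
    refine ⟨Q₁ ⊕ Q₂, inferInstance, card_sum ?_ ?_ ?_ ?_ c₁ c₂,
      ⟨C₁.comp C₂ fun hd _ _ hi => (t₂.matches_add hd hi).1⟩⟩
    · simp [subtrees, self_mem_subtrees]
    · simp [subtrees, self_mem_subtrees]
    · intro h; have := congrArg sizeOf h; grind
    · intro h; have := congrArg sizeOf h; grind
  | star t ih =>
    obtain ⟨Q, _, c, ⟨C⟩⟩ := ih
    refine ⟨Q, inferInstance, c.trans (Nat.pow_le_pow_right (by norm_num) ?_),
      ⟨C.star fun hd _ _ hi => (t.matches_add hd hi).1⟩⟩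
    exact Finset.card_le_card (Finset.subset_insert _ _)

end Cuts

/-! ### Positions of ultimately periodic words -/

namespace UPWord

variable {AP : Type*} (w : UPWord AP)

theorem length_v_pos : 0 < w.v.length := List.length_pos_iff.2 w.v_ne

theorem luv_eq : w.luv = w.lu + w.v.length := rfl

theorem luv_pos : 0 < w.luv := by have := w.length_v_pos; have := w.luv_eq; omega

theorem luvb_eq (b : ℕ) : w.luvb b = w.lu + b * w.v.length := rfl

theorem word_add_mul (e : ℕ) {i : ℕ} (hi : w.lu ≤ i) :
    w.word (i + e * w.v.length) = w.word i := by
  have hi' : w.u.length ≤ i := hi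
  have h : i + e * w.v.length - w.u.length = i - w.u.length + e * w.v.length := by omega
  simp only [word, dif_neg (show ¬ i + e * w.v.length < w.u.length by omega),
    dif_neg (not_lt.2 hi'), h, Nat.add_mul_mod_self_right]

theorem satAt_add_mul (t : SynTree AP) (e : ℕ) {i : ℕ} (hi : w.lu ≤ i) :
    t.SatAt w.word (i + e * w.v.length) ↔ t.SatAt w.word i :=
  t.satAt_add (fun _ h => w.word_add_mul e h) hi

theorem satAt_add_length (t : SynTree AP) {i : ℕ} (hi : w.lu ≤ i) :
    t.SatAt w.word (i + w.v.length) ↔ t.SatAt w.word i := by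
  simpa using w.satAt_add_mul t 1 hi

theorem M_lt_luv (j : ℕ) : w.M j < w.luv := by
  unfold M
  split
  · assumption
  · exact Nat.add_lt_add_left (Nat.mod_lt _ w.length_v_pos) _

theorem satAt_M (t : SynTree AP) (j : ℕ) : t.SatAt w.word (w.M j) ↔ t.SatAt w.word j := by
  unfold M
  split
  · rfl
  · rename_i h
    have := w.length_v_pos
    have h' : j = w.u.length + (j - w.u.length) % w.v.length +
        (j - w.u.length) / w.v.length * w.v.length := by
      have := Nat.mod_add_div (j - w.u.length) w.v.length
      rw [mul_comm] at this
      have e : w.luv = w.u.length + w.v.length := rfl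
      omega
    conv_rhs => rw [h']
    exact (w.satAt_add_mul t _ (Nat.le_add_right _ _)).symm

/-- A match that ends beyond `|u v^b|`, where `b` exceeds the number of states, can be shortened
by a positive multiple of `|v|`. -/
theorem exists_shorter_match [DecidableEq AP] {t : SynTree AP} {n i j : ℕ}
    (ht : t.subtrees.card ≤ n) (hi : i < w.luv) (hj : w.luvb (2 ^ n + 1) < j)
    (h : t.Matches w.word i j) :
    ∃ j' e, 0 < e ∧ w.luv < j' ∧ j = j' + e * w.v.length ∧ t.Matches w.word i j' := by
  obtain ⟨Q, _, hQ, ⟨C⟩⟩ := t.exists_cutSystem w.word w.lu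
  have hv := w.length_v_pos
  -- The cuts are made at `j - s|v|` for `s ≤ 2^n`. Of the `2^n + 1` copies of `v`, up to `2^n` are
  -- used up by `s|v|`; the remaining one keeps each cut beyond |uv|, hence beyond `i` and inside
  -- the periodic part.
  have hpos : ∀ s : Fin (2 ^ n + 1), w.luv + s * w.v.length < j := by
    intro s
    have : (s + 1) * w.v.length ≤ (2 ^ n + 1) * w.v.length := Nat.mul_le_mul_right _ s.2
    rw [luvb_eq] at hj
    rw [luv_eq]
    rw [add_mul] at this
    omega
  have hex : ∀ s : Fin (2 ^ n + 1), ∃ q, C.Pre i (j - s * w.v.length) q ∧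
      C.Post q (j - s * w.v.length) j := fun s =>
    C.cut (by have := hpos s; omega) (Nat.sub_le _ _) h
  choose q hpre hpost using hex
  -- Pigeonhole: `2^n + 1` cuts and at most `2^n` states.
  obtain ⟨s, s', hne, hq⟩ := Fintype.exists_ne_map_eq_of_card_lt q (by
    rw [Fintype.card_fin]
    exact (hQ.trans (Nat.pow_le_pow_right (by norm_num) ht)).trans_lt (Nat.lt_succ_self _))
  wlog hlt : s < s' generalizing s s'
  · exact this s' s hne.symm hq.symm (lt_of_le_of_ne (not_lt.1 hlt) hne.symm)
  have hlt' : (s : ℕ) < s' := hlt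
  obtain ⟨e, he⟩ : ∃ e, (s' : ℕ) = s + e := ⟨s' - s, by omega⟩
  have hs' := hpos s'
  rw [he, add_mul] at hs'
  have hpre' := hpre s'
  rw [he, add_mul, ← hq] at hpre'
  refine ⟨j - e * w.v.length, e, by omega, by omega, by omega, ?_⟩
  -- The initial part up to the earlier cut `j - s'|v|` is joined to the final part from the later
  -- cut `j - s|v|`, moved left by `e|v|`.
  refine C.join (s := j - (s * w.v.length + e * w.v.length)) (by omega) (by omega) hpre'
    (C.shift (d := e * w.v.length) (fun i hi => w.word_add_mul e hi) ?_ ?_)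
  · have := w.luv_eq; omega
  · have := hpost s
    rwa [show j - (s * w.v.length + e * w.v.length) + e * w.v.length = j - s * w.v.length by omega,
      Nat.sub_add_cancel (by omega)]

/-- The shortening is iterated. The alternative `e = 0 ∨ w.lu < j'` records that, if anything was
removed, then `j' - 1` lies in the periodic part, so that formulas have the same value at `j' - 1`
and `j - 1`. -/
theorem exists_bounded_match [DecidableEq AP] {t : SynTree AP} {n i j : ℕ}
    (ht : t.subtrees.card ≤ n) (hi : i < w.luv) (hij : i < j) (h : t.Matches w.word i j) :
    ∃ j' e, i < j' ∧ j' ≤ w.luvb (2 ^ n + 1) ∧ j = j' + e * w.v.length ∧ (e = 0 ∨ w.lu < j') ∧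
      t.Matches w.word i j' := by
  induction j using Nat.strong_induction_on with
  | _ j ih =>
    by_cases hj : j ≤ w.luvb (2 ^ n + 1)
    · exact ⟨j, 0, hij, hj, by simp, .inl rfl, h⟩
    obtain ⟨j₁, e₁, he₁, hj₁, rfl, h₁⟩ := w.exists_shorter_match ht hi (not_le.1 hj) h
    have := Nat.mul_pos he₁ w.length_v_pos
    obtain ⟨j₂, e₂, h₂, h₃, h₄, h₅, h₆⟩ := ih j₁ (by omega) (by omega) h₁
    refine ⟨j₂, e₂ + e₁, h₂, h₃, by rw [h₄, add_mul]; omega, .inr ?_, h₆⟩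
    rcases h₅ with rfl | h₅
    · have := w.luv_eq; omega
    · exact h₅

/-- A match beyond the bound has a counterpart within it whose last letter is congruent modulo |v|,
and there `t₂` has the same truth value. This is the only place where the number of unrollings
matters. -/
theorem satAt_trig_iff [DecidableEq AP] {t₁ t₂ : SynTree AP} {n i : ℕ}
    (ht : t₁.subtrees.card ≤ n) (hi : i < w.luv) :
    (SynTree.trig t₁ t₂).SatAt w.word i ↔ ∀ j, i < j → j ≤ w.luvb (2 ^ n + 1) →
      t₁.Matches w.word i j → t₂.SatAt w.word (w.M (j - 1)) := by
  simp only [SynTree.SatAt, satAt_M]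
  refine ⟨fun h j hij _ hm => h j hij hm, fun h j hij hm => ?_⟩
  obtain ⟨j', e, h₁, h₂, rfl, h₄, h₅⟩ := w.exists_bounded_match ht hi hij hm
  have := h j' h₁ h₂ h₅
  rcases h₄ with rfl | h₄
  · simpa using this
  · rwa [show j' + e * w.v.length - 1 = j' - 1 + e * w.v.length by omega,
      w.satAt_add_mul t₂ e (by omega)]

theorem satAt_next_iff {t : SynTree AP} :
    (SynTree.next t).SatAt w.word (w.luv - 1) ↔ t.SatAt w.word w.lu := by
  have := w.luv_pos
  rw [SynTree.SatAt, Nat.sub_add_cancel this, luv_eq, satAt_add_length _ _ le_rfl]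

/-- In an eventuality, the first witness can be used. -/
theorem satAt_untl_first {t₁ t₂ : SynTree AP} {i : ℕ} (h : (SynTree.untl t₁ t₂).SatAt w.word i) :
    ∃ j, i ≤ j ∧ t₂.SatAt w.word j ∧ (∀ k, i ≤ k → k < j → t₁.SatAt w.word k) ∧
      ∀ k, i ≤ k → k < j → ¬ t₂.SatAt w.word k := by
  classical
  obtain ⟨hj₁, hj₂, hj₃⟩ := Nat.find_spec h
  refine ⟨Nat.find h, hj₁, hj₂, hj₃, fun k hk hkj hs => Nat.find_min h hkj ⟨hk, hs, ?_⟩⟩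
  exact fun m hm hmk => hj₃ m hm (hmk.trans hkj)

theorem satAt_untl_iff_of_lt {t₁ t₂ : SynTree AP} {i : ℕ} (hi : i < w.lu) :
    (SynTree.untl t₁ t₂).SatAt w.word i ↔ ∃ j, (i ≤ j ∧ j < w.luv) ∧ t₂.SatAt w.word j ∧
      ∀ k, i ≤ k ∧ k < j → t₁.SatAt w.word k := by
  constructor
  · intro h
    obtain ⟨j, h₁, h₂, h₃, h₄⟩ := w.satAt_untl_first h
    refine ⟨j, ⟨h₁, ?_⟩, h₂, fun k hk => h₃ k hk.1 hk.2⟩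
    by_contra hj
    have hv := w.length_v_pos
    have := w.luv_eq
    -- If the first witness were at least |uv|, then one period earlier, still at or after |u| > i,
    -- there would be another.
    refine h₄ (j - w.v.length) (by omega) (by omega) ?_
    rwa [← w.satAt_add_length t₂ (by omega), Nat.sub_add_cancel (by omega)]
  · rintro ⟨j, h₁, h₂, h₃⟩
    exact ⟨j, h₁.1, h₂, fun k hk hkj => h₃ k ⟨hk, hkj⟩⟩

theorem mem_between {i j k : ℕ} : k ∈ between w i j ↔
    if i ≤ j then i ≤ k ∧ k < j else (w.lu ≤ k ∧ k < j) ∨ (i ≤ k ∧ k < w.luv) := by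
  unfold between
  split <;> simp

theorem satAt_untl_iff_of_ge {t₁ t₂ : SynTree AP} {i : ℕ} (hi : w.lu ≤ i) (hi' : i < w.luv) :
    (SynTree.untl t₁ t₂).SatAt w.word i ↔ ∃ j, (w.lu ≤ j ∧ j < w.luv) ∧ t₂.SatAt w.word j ∧
      ∀ k ∈ between w i j, t₁.SatAt w.word k := by
  have hv := w.length_v_pos
  have hl := w.luv_eq
  simp only [mem_between]
  constructor
  · intro h
    obtain ⟨j, h₁, h₂, h₃, h₄⟩ := w.satAt_untl_first h
    by_cases hj : j < w.luv
    · refine ⟨j, ⟨by omega, hj⟩, h₂, fun k hk => ?_⟩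
      rw [if_pos h₁] at hk
      exact h₃ k hk.1 hk.2
    · have h₂' : t₂.SatAt w.word (j - w.v.length) := by
        rwa [← w.satAt_add_length t₂ (by omega), Nat.sub_add_cancel (by omega)]
      -- By minimality of the witness `j`, its copy one period earlier precedes `i`. So `j` is
      -- reached from `i` by passing the end of the loop once, which is the second case of
      -- `between`.
      have hji : j - w.v.length < i := by
        by_contra hji
        exact h₄ _ (not_lt.1 hji) (by omega) h₂'
      refine ⟨j - w.v.length, ⟨by omega, by omega⟩, h₂', fun k hk => ?_⟩
      rw [if_neg (by omega)] at hk
      rcases hk with hk | hk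
      · rw [← w.satAt_add_length t₁ hk.1]
        exact h₃ _ (by omega) (by omega)
      · exact h₃ _ (by omega) (by omega)
  · rintro ⟨j, h₁, h₂, h₃⟩
    by_cases hij : i ≤ j
    · exact ⟨j, hij, h₂, fun k hk hkj => h₃ k (by rw [if_pos hij]; exact ⟨hk, hkj⟩)⟩
    · simp only [if_neg hij] at h₃
      -- A witness before `i` in the loop stands for its copy in the next round.
      refine ⟨j + w.v.length, by omega, (w.satAt_add_length t₂ h₁.1).2 h₂, fun k hk hkj => ?_⟩
      by_cases hkl : k < w.luv
      · exact h₃ k (.inr ⟨hk, hkl⟩)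
      · have := h₃ (k - w.v.length) (.inl (by omega))
        rwa [← w.satAt_add_length t₁ (by omega), Nat.sub_add_cancel (by omega)] at this

end UPWord

/-! ### The constraints on the variables `y` and `z` -/

section WordConstraints

variable {AP : Type*} [Fintype AP] [DecidableEq AP] {v : Var AP → Bool}

theorem holds_PhiReg (n : ℕ) (w : UPWord AP) (B : ℕ) : (PhiReg n w B).Holds v ↔
    (∀ k, 1 ≤ k → k ≤ n → v (.x k .eps) = true → ∀ i j, i ≤ j → j ≤ B →
      (v (.z w i j k) = true ↔ i = j)) ∧
    (∀ p, ∀ k, 1 ≤ k → k ≤ n → v (.x k (.prop p)) = true → ∀ i j, i ≤ j → j ≤ B →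
      (v (.z w i j k) = true ↔ j = i + 1 ∧ p ∈ w.word i)) ∧
    (∀ k, k ≤ n → ∀ m, 1 ≤ m → m < k → v (.x k .neg) = true → v (.l k m) = true →
      ∀ i j, i ≤ j → j ≤ B → (v (.z w i j k) = true ↔ j = i + 1 ∧ ¬ v (.z w i j m) = true)) ∧
    (∀ k, k ≤ n → ∀ m, 1 ≤ m → m < k → ∀ m', 1 ≤ m' → m' < k → v (.x k .or) = true →
      v (.l k m) = true → v (.r k m') = true → ∀ i j, i ≤ j → j ≤ B →
      (v (.z w i j k) = true ↔ v (.z w i j m) = true ∨ v (.z w i j m') = true)) ∧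
    (∀ k, k ≤ n → ∀ m, 1 ≤ m → m < k → ∀ m', 1 ≤ m' → m' < k → v (.x k .plus) = true →
      v (.l k m) = true → v (.r k m') = true → ∀ i j, i ≤ j → j ≤ B →
      (v (.z w i j k) = true ↔ v (.z w i j m) = true ∨ v (.z w i j m') = true)) ∧
    (∀ k, k ≤ n → ∀ m, 1 ≤ m → m < k → ∀ m', 1 ≤ m' → m' < k → v (.x k .comp) = true →
      v (.l k m) = true → v (.r k m') = true → ∀ i j, i ≤ j → j ≤ B →
      (v (.z w i j k) = true ↔
        ∃ t, (i ≤ t ∧ t < j + 1) ∧ v (.z w i t m) = true ∧ v (.z w t j m') = true)) ∧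
    (∀ k, k ≤ n → ∀ m, 1 ≤ m → m < k → v (.x k .star) = true → v (.l k m) = true →
      ∀ i j, i ≤ j → j ≤ B → (v (.z w i j k) = true ↔ i = j ∨
        ∃ t, (i + 1 ≤ t ∧ t < j + 1) ∧ v (.z w i t m) = true ∧ v (.z w t j k) = true)) := by
  simp only [PhiReg, holds_all, List.forall_mem_cons, List.not_mem_nil, false_imp_iff,
    implies_true, and_true]
  simp only [holds_bigAnd, holds_bigOr, List.Ico.mem, holds_and, holds_var, holds_or, holds_neg,
    holds_forLeaf, holds_forUn, holds_forBin, holds_infixes, holds_iff, holds_const, mem_props,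
    true_imp_iff]

theorem holds_PhiLTL (n : ℕ) (w : UPWord AP) (B : ℕ) : (PhiLTL n w B).Holds v ↔
    (∀ p, ∀ k, 1 ≤ k → k ≤ n → v (.x k (.prop p)) = true → ∀ i, i < w.luv →
      (v (.y w i k) = true ↔ p ∈ w.word i)) ∧
    (∀ k, k ≤ n → ∀ m, 1 ≤ m → m < k → v (.x k .neg) = true → v (.l k m) = true →
      ∀ i, i < w.luv → (v (.y w i k) = true ↔ ¬ v (.y w i m) = true)) ∧
    (∀ k, k ≤ n → ∀ m, 1 ≤ m → m < k → ∀ m', 1 ≤ m' → m' < k → v (.x k .or) = true →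
      v (.l k m) = true → v (.r k m') = true → ∀ i, i < w.luv →
      (v (.y w i k) = true ↔ v (.y w i m) = true ∨ v (.y w i m') = true)) ∧
    (∀ k, k ≤ n → ∀ m, 1 ≤ m → m < k → v (.x k .next) = true → v (.l k m) = true →
      (∀ i, i < w.luv - 1 → (v (.y w i k) = true ↔ v (.y w (i + 1) m) = true)) ∧
        (v (.y w (w.luv - 1) k) = true ↔ v (.y w w.lu m) = true)) ∧
    (∀ k, k ≤ n → ∀ m, 1 ≤ m → m < k → ∀ m', 1 ≤ m' → m' < k → v (.x k .untl) = true →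
      v (.l k m) = true → v (.r k m') = true →
      (∀ i, i < w.lu → (v (.y w i k) = true ↔ ∃ j, (i ≤ j ∧ j < w.luv) ∧
        v (.y w j m') = true ∧ ∀ t, i ≤ t ∧ t < j → v (.y w t m) = true)) ∧
      ∀ i, w.lu ≤ i ∧ i < w.luv → (v (.y w i k) = true ↔ ∃ j, (w.lu ≤ j ∧ j < w.luv) ∧
        v (.y w j m') = true ∧ ∀ t ∈ between w i j, v (.y w t m) = true)) ∧
    (∀ k, k ≤ n → ∀ m, 1 ≤ m → m < k → ∀ m', 1 ≤ m' → m' < k → v (.x k .trig) = true →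
      v (.l k m) = true → v (.r k m') = true → ∀ i, i < w.luv →
      (v (.y w i k) = true ↔ ∀ j, i + 1 ≤ j ∧ j < B + 1 → v (.z w i j m) = true →
        v (.y w (w.M (j - 1)) m') = true)) := by
  simp only [PhiLTL, holds_all, List.forall_mem_cons, List.not_mem_nil, false_imp_iff,
    implies_true, and_true]
  simp only [holds_bigAnd, holds_bigOr, List.Ico.mem, holds_and, holds_var, holds_or, holds_neg,
    holds_forLeaf, holds_forUn, holds_forBin, holds_iff, holds_imp, mem_props,
    true_imp_iff, holds_ite, zero_le, true_and]
  refine and_congr ?_ Iff.rfl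
  refine forall₄_congr fun p k _ _ => forall₃_congr fun _ i _ => ?_
  by_cases h : p ∈ w.word i <;> simp [h]

end WordConstraints

/-! ### The tree at a node -/

section Structure

variable {AP : Type*}

def SynTree.label : SynTree AP → Label AP
  | .prop p => .prop p
  | .eps => .eps
  | .neg _ => .neg
  | .or _ _ => .or
  | .next _ => .next
  | .untl _ _ => .untl
  | .trig _ _ => .trig
  | .plus _ _ => .plus
  | .comp _ _ => .comp
  | .star _ => .star

theorem Unravels.label {v : Var AP → Bool} {k : ℕ} {t : SynTree AP} (h : Unravels v k t) :
    v (.x k t.label) = true := by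
  cases h <;> assumption

theorem Unravels.exists_of_mem_subtrees [DecidableEq AP] {v : Var AP → Bool} {k : ℕ}
    (hk : 1 ≤ k) {t s : SynTree AP} (h : Unravels v k t) (hs : s ∈ t.subtrees) :
    ∃ m, 1 ≤ m ∧ m ≤ k ∧ Unravels v m s := by
  induction h with
  | prop | eps =>
    simp only [SynTree.subtrees, Finset.mem_singleton] at hs
    subst hs
    exact ⟨_, hk, le_rfl, by constructor; assumption⟩
  | @neg k m t hx hm hl ht ih | @next k m t hx hm hl ht ih | @star k m t hx hm hl ht ih =>
    simp only [SynTree.subtrees, Finset.mem_insert] at hs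
    rcases hs with rfl | hs
    · exact ⟨k, hk, le_rfl, by constructor <;> assumption⟩
    · obtain ⟨m₁, h₁, h₂, h₃⟩ := ih hm.1 hs
      exact ⟨m₁, h₁, by omega, h₃⟩
  | @or k m m' t t' hx hm hl ht hm' hr ht' ih ih' | @untl k m m' t t' hx hm hl ht hm' hr ht' ih ih'
  | @trig k m m' t t' hx hm hl ht hm' hr ht' ih ih' | @plus k m m' t t' hx hm hl ht hm' hr ht' ih ih'
  | @comp k m m' t t' hx hm hl ht hm' hr ht' ih ih' =>
    simp only [SynTree.subtrees, Finset.mem_insert, Finset.mem_union] at hs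
    rcases hs with rfl | hs | hs
    · exact ⟨k, hk, le_rfl, by constructor; exacts [hx, hm, hl, ht, hm', hr, ht']⟩
    · obtain ⟨m₁, h₁, h₂, h₃⟩ := ih hm.1 hs
      exact ⟨m₁, h₁, by omega, h₃⟩
    · obtain ⟨m₁, h₁, h₂, h₃⟩ := ih' hm'.1 hs
      exact ⟨m₁, h₁, by omega, h₃⟩

variable [Fintype AP] [DecidableEq AP] {v : Var AP → Bool} {n : ℕ}

theorem label_unique (hS : (PhiStr n).Holds v) {k : ℕ} (hk : 1 ≤ k) (hkn : k ≤ n) {c d : Label AP}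
    (hc : v (.x k c) = true) (hd : v (.x k d) = true) : c = d :=
  ((holds_strLabel n).1 ((holds_PhiStr n).1 hS).1).2 k hk hkn c d hc hd

theorem left_unique (hS : (PhiStr n).Holds v) {k m m' : ℕ} (hkn : k ≤ n) (hm : 1 ≤ m ∧ m < k)
    (hm' : 1 ≤ m' ∧ m' < k) (hc : v (.l k m) = true) (hd : v (.l k m') = true) : m = m' := by
  obtain ⟨m₀, -, h⟩ := (holds_strLeft n).1 ((holds_PhiStr n).1 hS).2.1 k (by omega) hkn
  rw [h m hm.1 hm.2 hc, h m' hm'.1 hm'.2 hd]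

theorem right_unique (hS : (PhiStr n).Holds v) {k m m' : ℕ} (hkn : k ≤ n) (hm : 1 ≤ m ∧ m < k)
    (hm' : 1 ≤ m' ∧ m' < k) (hc : v (.r k m) = true) (hd : v (.r k m') = true) : m = m' := by
  obtain ⟨m₀, -, h⟩ := (holds_strRight n).1 ((holds_PhiStr n).1 hS).2.2.1 k (by omega) hkn
  rw [h m hm.1 hm.2 hc, h m' hm'.1 hm'.2 hd]

/-- Labels and children are unique by the structural constraints alone; the sample plays no role. -/
theorem Unravels.unique (hS : (PhiStr n).Holds v) {k : ℕ} (hk : 1 ≤ k) (hkn : k ≤ n)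
    {t t' : SynTree AP} (h : Unravels v k t) (h' : Unravels v k t') : t = t' := by
  induction h generalizing t' with
  | prop | eps =>
    have hl := label_unique hS hk hkn h'.label ‹_›
    cases t' <;> simp_all [SynTree.label]
  | @neg k m t hx hm hl ht ih | @next k m t hx hm hl ht ih | @star k m t hx hm hl ht ih =>
    have hlab := label_unique hS hk hkn h'.label hx
    cases t' <;> simp only [SynTree.label, reduceCtorEq] at hlab
    cases h'
    rename_i m₁ hx₁ hm₁ hl₁ h₁
    cases left_unique hS hkn hm hm₁ hl hl₁
    rw [ih hm.1 (by omega) h₁]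
  | @or k m m' t s hx hm hl ht hm' hr hs ih ih' | @untl k m m' t s hx hm hl ht hm' hr hs ih ih'
  | @trig k m m' t s hx hm hl ht hm' hr hs ih ih' | @plus k m m' t s hx hm hl ht hm' hr hs ih ih'
  | @comp k m m' t s hx hm hl ht hm' hr hs ih ih' =>
    have hlab := label_unique hS hk hkn h'.label hx
    cases t' <;> simp only [SynTree.label, reduceCtorEq] at hlab
    cases h'
    rename_i m₁ m₂ hx₁ hm₁ hl₁ hm₂ hl₂ h₁ h₂
    cases left_unique hS hkn hm hm₁ hl hl₁
    cases right_unique hS hkn hm' hm₂ hr hl₂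
    rw [ih hm.1 (by omega) h₁, ih' hm'.1 (by omega) h₂]

/-- Each subtree is unravelled at some node up to `k`, and by uniqueness a node yields one tree
only, so distinct subtrees occupy distinct nodes. -/
theorem Unravels.card_subtrees_le (hS : (PhiStr n).Holds v) {k : ℕ} (hk : 1 ≤ k) (hkn : k ≤ n)
    {t : SynTree AP} (h : Unravels v k t) : t.subtrees.card ≤ k := by
  choose! f hf₁ hf₂ hf₃ using fun s hs => h.exists_of_mem_subtrees (s := s) hk hs
  have := Finset.card_le_card_of_injOn (t := Finset.Icc 1 k) f
    (fun s hs => by simpa using ⟨hf₁ s hs, hf₂ s hs⟩) (fun s hs s' hs' he => by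
      have h₁ := hf₃ s hs
      rw [he] at h₁
      exact h₁.unique hS (hf₁ s' hs') ((hf₂ s' hs').trans hkn) (hf₃ s' hs'))
  simpa using this

/-- The labels `¬`, `∨` and `p` occur in formulas and in atomic expressions alike, so labels alone
do not determine the type of a node. Hence one induction for three readings: `a_k` certifies the
atomic one, and a node with label `¬` or `∨` may be read as a regular expression only under this
certificate. -/
theorem exists_unravels (hS : (PhiStr n).Holds v) {k : ℕ} (hk : 1 ≤ k) (hkn : k ≤ n) :
    (v (.a k) = true → ∃ ξ : AtomExpr AP, Unravels v k ξ.tree) ∧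
    ((∃ c ∈ labR AP, v (.x k c) = true) →
      (v (.x k .neg) = true ∨ v (.x k .or) = true → v (.a k) = true) →
      ∃ ρ : RegExpr AP, Unravels v k ρ.tree) ∧
    ((∃ c ∈ labF AP, v (.x k c) = true) → ∃ φ : PSL AP, Unravels v k φ.tree) := by
  obtain ⟨hlab, hleft, hright, hord₁, hord₂, hord₃, hat, hend⟩ := (holds_PhiStr n).1 hS
  rw [holds_strLeft] at hleft
  rw [holds_strRight] at hright
  rw [holds_strOrder] at hord₁ hord₂ hord₃
  obtain ⟨hat₁, hat₂, hat₃, hat₄, hat₅⟩ := (holds_strAtomic n).1 hat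
  have hend₁ := ((holds_strEnds n).1 hend).1
  induction k using Nat.strong_induction_on with
  | _ k ih =>
    -- Children are guaranteed from node 2 on; node 1 is a leaf and cannot carry an inner label.
    have children (c : Label AP) (hc : v (.x k c) = true) (hne : c ≠ .eps)
        (hne' : ∀ p, c ≠ .prop p) : ∃ m m', (1 ≤ m ∧ m < k) ∧ v (.l k m) = true ∧
          (1 ≤ m' ∧ m' < k) ∧ v (.r k m') = true := by
      have hk2 : 2 ≤ k := by
        by_contra hk2
        obtain rfl : k = 1 := by omega
        rcases hend₁ with h | ⟨p, h⟩
        · exact hne (label_unique hS le_rfl hkn hc h)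
        · exact hne' p (label_unique hS le_rfl hkn hc h)
      obtain ⟨m, hm, -⟩ := hleft k hk2 hkn
      obtain ⟨m', hm', -⟩ := hright k hk2 hkn
      exact ⟨m, m', ⟨hm.1, hm.2.1⟩, hm.2.2, ⟨hm'.1, hm'.2.1⟩, hm'.2.2⟩
    have hA : v (.a k) = true → ∃ ξ : AtomExpr AP, Unravels v k ξ.tree := by
      intro ha
      obtain ⟨c, hc, hx⟩ := hat₁ k hk hkn ha
      rcases mem_labA.1 hc with rfl | rfl | ⟨p, rfl⟩
      · obtain ⟨m, m', hm, hl, hm', hr⟩ := children _ hx (by simp) (by simp)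
        obtain ⟨ξ, hξ⟩ := (ih m hm.2 hm.1 (by omega)).1
          (hat₂ k hkn m hm.1 hm.2 _ (.inl rfl) ha hx hl)
        exact ⟨.neg ξ, .neg hx hm hl hξ⟩
      · obtain ⟨m, m', hm, hl, hm', hr⟩ := children _ hx (by simp) (by simp)
        obtain ⟨ξ, hξ⟩ := (ih m hm.2 hm.1 (by omega)).1
          (hat₂ k hkn m hm.1 hm.2 _ (.inr rfl) ha hx hl)
        obtain ⟨ξ', hξ'⟩ := (ih m' hm'.2 hm'.1 (by omega)).1
          (hat₃ k hkn m' hm'.1 hm'.2 ha hx hr)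
        exact ⟨.or ξ ξ', .or hx hm hl hξ hm' hr hξ'⟩
      · exact ⟨.prop p, .prop hx⟩
    refine ⟨hA, ?_, ?_⟩
    · rintro ⟨c, hc, hx⟩ ha
      rcases mem_labR.1 hc with rfl | rfl | rfl | rfl | rfl | rfl | ⟨p, rfl⟩
      · exact ⟨.eps, .eps hx⟩
      · obtain ⟨m, m', hm, hl, hm', hr⟩ := children _ hx (by simp) (by simp)
        obtain ⟨h₁, h₂⟩ := hord₁ k hkn m hm.1 hm.2 m' hm'.1 hm'.2 _ (by simp) hx hl hr
        obtain ⟨ρ, hρ⟩ := (ih m hm.2 hm.1 (by omega)).2.1 h₁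
          (hat₄ k hkn m hm.1 hm.2 _ (by simp) hx hl)
        obtain ⟨ρ', hρ'⟩ := (ih m' hm'.2 hm'.1 (by omega)).2.1 h₂
          (hat₅ k hkn m' hm'.1 hm'.2 _ (by simp) hx hr)
        exact ⟨.plus ρ ρ', .plus hx hm hl hρ hm' hr hρ'⟩
      · obtain ⟨m, m', hm, hl, hm', hr⟩ := children _ hx (by simp) (by simp)
        obtain ⟨h₁, h₂⟩ := hord₁ k hkn m hm.1 hm.2 m' hm'.1 hm'.2 _ (by simp) hx hl hr
        obtain ⟨ρ, hρ⟩ := (ih m hm.2 hm.1 (by omega)).2.1 h₁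
          (hat₄ k hkn m hm.1 hm.2 _ (by simp) hx hl)
        obtain ⟨ρ', hρ'⟩ := (ih m' hm'.2 hm'.1 (by omega)).2.1 h₂
          (hat₅ k hkn m' hm'.1 hm'.2 _ (by simp) hx hr)
        exact ⟨.comp ρ ρ', .comp hx hm hl hρ hm' hr hρ'⟩
      · obtain ⟨m, m', hm, hl, hm', hr⟩ := children _ hx (by simp) (by simp)
        obtain ⟨h₁, h₂⟩ := hord₁ k hkn m hm.1 hm.2 m' hm'.1 hm'.2 _ (by simp) hx hl hr
        obtain ⟨ρ, hρ⟩ := (ih m hm.2 hm.1 (by omega)).2.1 h₁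
          (hat₄ k hkn m hm.1 hm.2 _ (by simp) hx hl)
        exact ⟨.star ρ, .star hx hm hl hρ⟩
      · obtain ⟨ξ, hξ⟩ := hA (ha (.inl hx))
        exact ⟨.atom ξ, hξ⟩
      · obtain ⟨ξ, hξ⟩ := hA (ha (.inr hx))
        exact ⟨.atom ξ, hξ⟩
      · exact ⟨.atom (.prop p), .prop hx⟩
    · rintro ⟨c, hc, hx⟩
      rcases mem_labF.1 hc with rfl | rfl | rfl | rfl | rfl | ⟨p, rfl⟩
      · obtain ⟨m, m', hm, hl, hm', hr⟩ := children _ hx (by simp) (by simp)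
        obtain ⟨h₁, h₂⟩ := hord₂ k hkn m hm.1 hm.2 m' hm'.1 hm'.2 _ (by simp) hx hl hr
        obtain ⟨φ, hφ⟩ := (ih m hm.2 hm.1 (by omega)).2.2 h₁
        exact ⟨.next φ, .next hx hm hl hφ⟩
      · obtain ⟨m, m', hm, hl, hm', hr⟩ := children _ hx (by simp) (by simp)
        obtain ⟨h₁, h₂⟩ := hord₂ k hkn m hm.1 hm.2 m' hm'.1 hm'.2 _ (by simp) hx hl hr
        obtain ⟨φ, hφ⟩ := (ih m hm.2 hm.1 (by omega)).2.2 h₁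
        obtain ⟨φ', hφ'⟩ := (ih m' hm'.2 hm'.1 (by omega)).2.2 h₂
        exact ⟨.untl φ φ', .untl hx hm hl hφ hm' hr hφ'⟩
      · obtain ⟨m, m', hm, hl, hm', hr⟩ := children _ hx (by simp) (by simp)
        obtain ⟨h₁, h₂⟩ := hord₃ k hkn m hm.1 hm.2 m' hm'.1 hm'.2 _ (by simp) hx hl hr
        obtain ⟨ρ, hρ⟩ := (ih m hm.2 hm.1 (by omega)).2.1 h₁
          (hat₄ k hkn m hm.1 hm.2 _ (by simp) hx hl)
        obtain ⟨φ', hφ'⟩ := (ih m' hm'.2 hm'.1 (by omega)).2.2 h₂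
        exact ⟨.trig ρ φ', .trig hx hm hl hρ hm' hr hφ'⟩
      · obtain ⟨m, m', hm, hl, hm', hr⟩ := children _ hx (by simp) (by simp)
        obtain ⟨h₁, h₂⟩ := hord₂ k hkn m hm.1 hm.2 m' hm'.1 hm'.2 _ (by simp) hx hl hr
        obtain ⟨φ, hφ⟩ := (ih m hm.2 hm.1 (by omega)).2.2 h₁
        exact ⟨.neg φ, .neg hx hm hl hφ⟩
      · obtain ⟨m, m', hm, hl, hm', hr⟩ := children _ hx (by simp) (by simp)
        obtain ⟨h₁, h₂⟩ := hord₂ k hkn m hm.1 hm.2 m' hm'.1 hm'.2 _ (by simp) hx hl hr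
        obtain ⟨φ, hφ⟩ := (ih m hm.2 hm.1 (by omega)).2.2 h₁
        obtain ⟨φ', hφ'⟩ := (ih m' hm'.2 hm'.1 (by omega)).2.2 h₂
        exact ⟨.or φ φ', .or hx hm hl hφ hm' hr hφ'⟩
      · exact ⟨.prop p, .prop hx⟩

end Structure

/-! ### The variables `y` and `z` in a model -/

section Evaluation

variable {AP : Type*} [Fintype AP] [DecidableEq AP] {v : Var AP → Bool} {n : ℕ} {w : UPWord AP}

theorem AtomExpr.z_iff {B : ℕ} (hR : (PhiReg n w B).Holds v) (ξ : AtomExpr AP) {k : ℕ}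
    (hk : 1 ≤ k) (hkn : k ≤ n) (h : Unravels v k ξ.tree) {i j : ℕ} (hij : i ≤ j) (hj : j ≤ B) :
    v (.z w i j k) = true ↔ ξ.tree.Matches w.word i j := by
  obtain ⟨-, hprop, hneg, hor, -⟩ := (holds_PhiReg n w B).1 hR
  induction ξ generalizing k with
  | prop p =>
    cases h with | prop hx
    exact hprop p k hk hkn hx i j hij hj
  | neg ξ ih =>
    cases h with | neg hx hm hl h
    rw [hneg k hkn _ hm.1 hm.2 hx hl i j hij hj, ih hm.1 (by omega) h]
    rfl
  | or ξ₁ ξ₂ ih₁ ih₂ =>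
    cases h with | or hx hm hl h hm' hr h'
    rw [hor k hkn _ hm.1 hm.2 _ hm'.1 hm'.2 hx hl hr i j hij hj, ih₁ hm.1 (by omega) h,
      ih₂ hm'.1 (by omega) h']
    rfl

theorem RegExpr.z_iff {B : ℕ} (hR : (PhiReg n w B).Holds v) (ρ : RegExpr AP) {k : ℕ}
    (hk : 1 ≤ k) (hkn : k ≤ n) (h : Unravels v k ρ.tree) {i j : ℕ} (hij : i ≤ j) (hj : j ≤ B) :
    v (.z w i j k) = true ↔ ρ.tree.Matches w.word i j := by
  obtain ⟨heps, -, -, -, hplus, hcomp, hstar⟩ := (holds_PhiReg n w B).1 hR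
  induction ρ generalizing k i j with
  | eps =>
    cases h with | eps hx
    exact heps k hk hkn hx i j hij hj
  | atom ξ => exact ξ.z_iff hR hk hkn h hij hj
  | plus ρ₁ ρ₂ ih₁ ih₂ =>
    cases h with | plus hx hm hl h hm' hr h'
    rw [hplus k hkn _ hm.1 hm.2 _ hm'.1 hm'.2 hx hl hr i j hij hj,
      ih₁ hm.1 (by omega) h hij hj, ih₂ hm'.1 (by omega) h' hij hj]
    rfl
  | comp ρ₁ ρ₂ ih₁ ih₂ =>
    cases h with | comp hx hm hl h hm' hr h'
    rw [hcomp k hkn _ hm.1 hm.2 _ hm'.1 hm'.2 hx hl hr i j hij hj]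
    refine exists_congr fun t => ?_
    constructor
    · rintro ⟨ht, h₁, h₂⟩
      exact ⟨by omega, by omega, (ih₁ hm.1 (by omega) h (by omega) (by omega)).1 h₁,
        (ih₂ hm'.1 (by omega) h' (by omega) (by omega)).1 h₂⟩
    · rintro ⟨ht, ht', h₁, h₂⟩
      exact ⟨by omega, (ih₁ hm.1 (by omega) h (by omega) (by omega)).2 h₁,
        (ih₂ hm'.1 (by omega) h' (by omega) (by omega)).2 h₂⟩
  | star ρ ih =>
    cases h with | star hx hm hl h
    have hstar := hstar k hkn _ hm.1 hm.2 hx hl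
    obtain ⟨d, hd⟩ : ∃ d, j - i = d := ⟨_, rfl⟩
    -- The constraint for the star refers to `z` at the same node `k`, but on the shorter infix [t,
    -- j) with t > i, so an inner induction on the length is needed.
    induction d using Nat.strong_induction_on generalizing i with
    | _ d ihd =>
      rw [hstar i j hij hj]
      simp only [tree, SynTree.Matches]
      rw [starMatch_iff]
      refine or_congr Iff.rfl (exists_congr fun t => ?_)
      constructor
      · rintro ⟨ht, h₁, h₂⟩
        exact ⟨by omega, by omega, (ih hm.1 (by omega) h (by omega) (by omega)).1 h₁,
          (ihd (j - t) (by omega) (by omega) rfl).1 h₂⟩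
      · rintro ⟨ht, ht', h₁, h₂⟩
        exact ⟨by omega, (ih hm.1 (by omega) h (by omega) (by omega)).2 h₁,
          (ihd (j - t) (by omega) (by omega) rfl).2 h₂⟩

/-- Each constraint on `y` mirrors the semantics restricted to the positions of `uv`. For the
triggers operator the left argument sits at a node below `k ≤ n` and so has at most `n` subtrees, as
the bound on its matches requires. -/
theorem PSL.y_iff (hS : (PhiStr n).Holds v) (hW : (PhiWord n w).Holds v) (φ : PSL AP) {k : ℕ}
    (hk : 1 ≤ k) (hkn : k ≤ n) (h : Unravels v k φ.tree) {i : ℕ} (hi : i < w.luv) :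
    v (.y w i k) = true ↔ φ.tree.SatAt w.word i := by
  obtain ⟨hR, hL⟩ := (holds_and _ _).1 hW
  obtain ⟨hprop, hneg, hor, hnext, huntl, htrig⟩ := (holds_PhiLTL n w _).1 hL
  have hluv := w.luv_eq
  induction φ generalizing k i with
  | prop p =>
    cases h with | prop hx
    exact hprop p k hk hkn hx i hi
  | neg φ ih =>
    cases h with | neg hx hm hl h
    exact (hneg k hkn _ hm.1 hm.2 hx hl i hi).trans (not_congr (ih hm.1 (by omega) h hi))
  | or φ₁ φ₂ ih₁ ih₂ =>
    cases h with | or hx hm hl h hm' hr h'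
    exact (hor k hkn _ hm.1 hm.2 _ hm'.1 hm'.2 hx hl hr i hi).trans
      (or_congr (ih₁ hm.1 (by omega) h hi) (ih₂ hm'.1 (by omega) h' hi))
  | next φ ih =>
    cases h with | next hx hm hl h
    obtain ⟨h₁, h₂⟩ := hnext k hkn _ hm.1 hm.2 hx hl
    by_cases hi' : i < w.luv - 1
    · exact (h₁ i hi').trans (ih hm.1 (by omega) h (by omega))
    · obtain rfl : i = w.luv - 1 := by omega
      rw [tree, w.satAt_next_iff]
      exact h₂.trans (ih hm.1 (by omega) h (by have := w.length_v_pos; omega))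
  | untl φ₁ φ₂ ih₁ ih₂ =>
    cases h with | untl hx hm hl h hm' hr h'
    obtain ⟨h₁, h₂⟩ := huntl k hkn _ hm.1 hm.2 _ hm'.1 hm'.2 hx hl hr
    rw [tree]
    by_cases hi' : i < w.lu
    · rw [h₁ i hi', w.satAt_untl_iff_of_lt hi']
      refine exists_congr fun j => and_congr_right fun hj => and_congr
        (ih₂ hm'.1 (by omega) h' hj.2) (forall₂_congr fun t ht => ih₁ hm.1 (by omega) h (by omega))
    · rw [h₂ i ⟨by omega, hi⟩, w.satAt_untl_iff_of_ge (by omega) hi]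
      refine exists_congr fun j => and_congr_right fun hj => and_congr
        (ih₂ hm'.1 (by omega) h' hj.2) (forall₂_congr fun t ht => ih₁ hm.1 (by omega) h ?_)
      rw [w.mem_between] at ht
      split at ht <;> omega
  | trig ρ φ ih =>
    cases h with | trig hx hm hl h hm' hr h'
    rw [htrig k hkn _ hm.1 hm.2 _ hm'.1 hm'.2 hx hl hr i hi, tree,
      w.satAt_trig_iff (n := n) ((h.card_subtrees_le hS hm.1 (by omega)).trans (by omega)) hi]
    constructor
    · intro H j hij hj hz
      exact (ih hm'.1 (by omega) h' (w.M_lt_luv _)).1 <|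
        H j (by omega) ((ρ.z_iff hR hm.1 (by omega) h hij.le hj).2 hz)
    · intro H j hj hz
      exact (ih hm'.1 (by omega) h' (w.M_lt_luv _)).2 <| H j (by omega) (by omega)
        ((ρ.z_iff hR hm.1 (by omega) h (by omega) (by omega)).1 hz)

end Evaluation

/-! ### The formula of a model -/

section Extraction

variable {AP : Type*}

theorem AtomExpr.tree_injective : Function.Injective (AtomExpr.tree (AP := AP)) := by
  intro ξ ξ' h
  induction ξ generalizing ξ' <;> cases ξ' <;> simp only [tree, reduceCtorEq, SynTree.prop.injEq,
    SynTree.neg.injEq, SynTree.or.injEq] at h <;> grind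

/-- The constructor `atom` leaves no trace in the tree, but the roots of atomic expressions are `p`,
`¬` or `∨`, which no other constructor produces. -/
theorem RegExpr.tree_injective : Function.Injective (RegExpr.tree (AP := AP)) := by
  intro ρ ρ' h
  induction ρ generalizing ρ' with
  | atom ξ =>
    cases ρ' with
    | atom ξ' => exact congrArg _ (AtomExpr.tree_injective h)
    | _ => cases ξ <;> simp [tree, AtomExpr.tree] at h
  | _ =>
    cases ρ' with
    | atom ξ' => cases ξ' <;> simp [tree, AtomExpr.tree] at h
    | _ => simp only [tree, reduceCtorEq, SynTree.plus.injEq, SynTree.comp.injEq,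
        SynTree.star.injEq] at h <;> grind

theorem PSL.tree_injective : Function.Injective (PSL.tree (AP := AP)) := by
  intro φ φ' h
  induction φ generalizing φ' <;> cases φ' <;> simp only [tree, reduceCtorEq,
    SynTree.prop.injEq, SynTree.neg.injEq, SynTree.or.injEq, SynTree.next.injEq,
    SynTree.untl.injEq, SynTree.trig.injEq] at h <;>
    grind [Function.Injective, RegExpr.tree_injective (AP := AP)]

theorem exists_extracts [Fintype AP] [DecidableEq AP] {S : Sample AP} {n : ℕ} (hn : 1 ≤ n)
    {v : Var AP → Bool} (hv : (Phi S n).Holds v) :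
    ∃ φ, Extracts v n φ ∧ (∀ ψ, Extracts v n ψ → ψ = φ) ∧ S.Consistent φ ∧ φ.size ≤ n := by
  obtain ⟨hS, hC⟩ := (holds_and _ _).1 hv
  have hend := ((holds_strEnds n).1 ((holds_PhiStr n).1 hS).2.2.2.2.2.2.2).2
  obtain ⟨φ, hφ⟩ := (exists_unravels hS hn le_rfl).2.2 hend
  simp only [PhiCst, holds_and, holds_bigAnd, Finset.mem_toList, holds_neg, holds_var] at hC
  refine ⟨φ, hφ, fun ψ hψ => PSL.tree_injective (hψ.unique hS hn le_rfl hφ), ⟨?_, ?_⟩,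
    hφ.card_subtrees_le hS hn le_rfl⟩
  · intro w hw
    obtain ⟨h₁, h₂⟩ := hC.1 w hw
    rwa [φ.y_iff hS h₁ hn le_rfl hφ w.luv_pos, PSL.satAt_tree_zero] at h₂
  · intro w hw
    obtain ⟨h₁, h₂⟩ := hC.2 w hw
    rwa [φ.y_iff hS h₁ hn le_rfl hφ w.luv_pos, PSL.satAt_tree_zero] at h₂

end Extraction

/-! ### Numbering the subtrees of a tree -/

/-- A numbering of a finite set by `1, …, card`, along a height function. -/
theorem exists_numbering {β : Type*} [DecidableEq β] [Nonempty β] (s : Finset β) (f : β → ℕ) :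
    ∃ (node : ℕ → β) (idx : β → ℕ),
      (∀ b ∈ s, 1 ≤ idx b ∧ idx b ≤ s.card ∧ node (idx b) = b) ∧
      (∀ k, 1 ≤ k → k ≤ s.card → node k ∈ s ∧ idx (node k) = k) ∧
      ∀ b ∈ s, ∀ c ∈ s, f b < f c → idx b < idx c := by
  induction s using Finset.induction_on_max_value f with
  | empty =>
    refine ⟨fun _ => Classical.arbitrary β, fun _ => 0, by simp, fun k h h' => ?_, by simp⟩
    rw [Finset.card_empty] at h'
    omega
  | insert a s ha hmax ih =>
    obtain ⟨node, idx, h₁, h₂, h₃⟩ := ih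
    -- The element `a` has maximal height and receives the last number.
    refine ⟨Function.update node (s.card + 1) a, Function.update idx a (s.card + 1), ?_, ?_, ?_⟩
    · intro b hb
      rw [Finset.card_insert_of_notMem ha]
      rcases Finset.mem_insert.1 hb with rfl | hb
      · simp
      · have hne : b ≠ a := fun h => ha (h ▸ hb)
        obtain ⟨e₁, e₂, e₃⟩ := h₁ b hb
        rw [Function.update_of_ne hne, Function.update_of_ne (by omega)]
        exact ⟨e₁, by omega, e₃⟩
    · intro k hk hk'
      rw [Finset.card_insert_of_notMem ha] at hk'
      by_cases hks : k = s.card + 1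
      · subst hks; simp
      · obtain ⟨e₁, e₂⟩ := h₂ k hk (by omega)
        rw [Function.update_of_ne hks, Function.update_of_ne (ne_of_mem_of_not_mem e₁ ha)]
        exact ⟨Finset.mem_insert_of_mem e₁, e₂⟩
    · intro b hb c hc hbc
      rcases Finset.mem_insert.1 hb with rfl | hb
      · rcases Finset.mem_insert.1 hc with rfl | hc
        · omega
        · have := hmax c hc; omega
      · rw [Function.update_of_ne (ne_of_mem_of_not_mem hb ha)]
        rcases Finset.mem_insert.1 hc with rfl | hc
        · have := (h₁ b ‹b ∈ s›).2.1
          rw [Function.update_self]; omega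
        · rw [Function.update_of_ne (ne_of_mem_of_not_mem hc ha)]
          exact h₃ b hb c hc hbc

section Numbering

variable {AP : Type*}

/-- The left child; a leaf is its own child. -/
def SynTree.left : SynTree AP → SynTree AP
  | .prop p => .prop p
  | .eps => .eps
  | .neg t | .next t | .star t => t
  | .or t _ | .untl t _ | .trig t _ | .plus t _ | .comp t _ => t

/-- The right child, or the only child; a leaf is its own child. -/
def SynTree.right : SynTree AP → SynTree AP
  | .prop p => .prop p
  | .eps => .eps
  | .neg t | .next t | .star t => t
  | .or _ t | .untl _ t | .trig _ t | .plus _ t | .comp _ t => t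

/-- The labels of inner nodes. -/
def Label.Inner (c : Label AP) : Prop := c ≠ .eps ∧ ∀ p, c ≠ .prop p

theorem SynTree.sizeOf_left_lt {t : SynTree AP} (h : t.label.Inner) :
    sizeOf t.left < sizeOf t := by
  cases t <;> simp [label, Label.Inner] at h <;> simp [left] <;> omega

theorem SynTree.sizeOf_right_lt {t : SynTree AP} (h : t.label.Inner) :
    sizeOf t.right < sizeOf t := by
  cases t <;> simp [label, Label.Inner] at h <;> simp [right]

variable [DecidableEq AP]

theorem SynTree.left_mem_subtrees (t : SynTree AP) : t.left ∈ t.subtrees := by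
  cases t <;> simp [left, subtrees, self_mem_subtrees]

theorem SynTree.right_mem_subtrees (t : SynTree AP) : t.right ∈ t.subtrees := by
  cases t <;> simp [right, subtrees, self_mem_subtrees]

/-- A numbering of the subtrees of `t` by `1, …, n` in which subtrees precede larger ones. -/
structure SynTree.Numbering (t : SynTree AP) (n : ℕ) where
  node : ℕ → SynTree AP
  idx : SynTree AP → ℕ
  idx_pos : ∀ {s}, s ∈ t.subtrees → 1 ≤ idx s
  idx_le : ∀ {s}, s ∈ t.subtrees → idx s ≤ n
  node_idx : ∀ {s}, s ∈ t.subtrees → node (idx s) = s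
  node_mem : ∀ {k}, 1 ≤ k → k ≤ n → node k ∈ t.subtrees
  idx_node : ∀ {k}, 1 ≤ k → k ≤ n → idx (node k) = k
  idx_lt : ∀ {s s'}, s ∈ t.subtrees → s' ∈ t.subtrees → sizeOf s < sizeOf s' → idx s < idx s'

theorem SynTree.nonempty_numbering (t : SynTree AP) : Nonempty (t.Numbering t.subtrees.card) := by
  have : Nonempty (SynTree AP) := ⟨t⟩
  obtain ⟨node, idx, h₁, h₂, h₃⟩ := exists_numbering t.subtrees sizeOf
  exact ⟨⟨node, idx, fun h => (h₁ _ h).1, fun h => (h₁ _ h).2.1, fun h => (h₁ _ h).2.2,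
    fun h h' => (h₂ _ h h').1, fun h h' => (h₂ _ h h').2, fun h h' => h₃ _ h _ h'⟩⟩

end Numbering

/-! ### The model given by a numbering -/

namespace SynTree.Numbering

variable {AP : Type*} [DecidableEq AP] {t : SynTree AP} {n : ℕ} (E : t.Numbering n)

open Classical in
/-- The interpretation that describes the numbered syntax tree and its semantics. -/
noncomputable def val : Var AP → Bool
  | .x k c => decide ((E.node k).label = c)
  -- Leaves with k ≥ 2 must have children in the encoding as well; node 1 serves as a dummy.
  | .l k m => decide (m = if (E.node k).label.Inner then E.idx (E.node k).left else 1)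
  | .r k m => decide (m = if (E.node k).label.Inner then E.idx (E.node k).right else 1)
  | .a k => decide (∃ ξ : AtomExpr AP, ξ.tree = E.node k)
  | .y w i k => decide ((E.node k).SatAt w.word i)
  | .z w i j k => decide ((E.node k).Matches w.word i j)

theorem val_x {k : ℕ} {c : Label AP} : E.val (.x k c) = true ↔ (E.node k).label = c := by
  simp [val]

theorem val_a {k : ℕ} : E.val (.a k) = true ↔ ∃ ξ : AtomExpr AP, ξ.tree = E.node k := by
  simp [val]

theorem val_y {k : ℕ} {w : UPWord AP} {i : ℕ} :
    E.val (.y w i k) = true ↔ (E.node k).SatAt w.word i := by simp [val]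

theorem val_z {k : ℕ} {w : UPWord AP} {i j : ℕ} :
    E.val (.z w i j k) = true ↔ (E.node k).Matches w.word i j := by simp [val]

/-- The whole tree is strictly larger than its other subtrees, so the last number can belong to
nothing else. -/
theorem node_root : E.node n = t := by
  have ht := t.self_mem_subtrees
  have h₁ := E.idx_pos ht
  have h₂ := E.idx_le ht
  have hm := E.node_mem (k := n) (by omega) le_rfl
  by_contra hne
  have := E.idx_lt hm ht (by
    by_contra hs
    exact hne (eq_of_mem_subtrees_of_sizeOf_le hm (not_lt.1 hs)))
  rw [E.idx_node (by omega) le_rfl] at this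
  omega

variable {E} {k : ℕ}

theorem left_mem (hk : 1 ≤ k) (hkn : k ≤ n) : (E.node k).left ∈ t.subtrees :=
  subtrees_subset (E.node_mem hk hkn) (left_mem_subtrees _)

theorem right_mem (hk : 1 ≤ k) (hkn : k ≤ n) : (E.node k).right ∈ t.subtrees :=
  subtrees_subset (E.node_mem hk hkn) (right_mem_subtrees _)

theorem idx_left_lt (hk : 1 ≤ k) (hkn : k ≤ n) (h : (E.node k).label.Inner) :
    E.idx (E.node k).left < k := by
  have := E.idx_lt (left_mem hk hkn) (E.node_mem hk hkn) (sizeOf_left_lt h)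
  rwa [E.idx_node hk hkn] at this

theorem idx_right_lt (hk : 1 ≤ k) (hkn : k ≤ n) (h : (E.node k).label.Inner) :
    E.idx (E.node k).right < k := by
  have := E.idx_lt (right_mem hk hkn) (E.node_mem hk hkn) (sizeOf_right_lt h)
  rwa [E.idx_node hk hkn] at this

theorem node_of_val_l {m : ℕ} (hk : 1 ≤ k) (hkn : k ≤ n) (h : (E.node k).label.Inner)
    (hl : E.val (.l k m) = true) : E.node m = (E.node k).left := by
  simp only [val, decide_eq_true_eq, if_pos h] at hl
  rw [hl, E.node_idx (left_mem hk hkn)]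

theorem node_of_val_r {m : ℕ} (hk : 1 ≤ k) (hkn : k ≤ n) (h : (E.node k).label.Inner)
    (hr : E.val (.r k m) = true) : E.node m = (E.node k).right := by
  simp only [val, decide_eq_true_eq, if_pos h] at hr
  rw [hr, E.node_idx (right_mem hk hkn)]

theorem not_inner_node_one (hn : 1 ≤ n) : ¬ (E.node 1).label.Inner := fun h => by
  have h₁ := idx_left_lt le_rfl hn h
  have h₂ := E.idx_pos (left_mem (E := E) le_rfl hn)
  omega

variable (E) [Fintype AP]

/-- The constraints concern every node with a given label, whatever its type. Since
`SynTree.Matches` gives a meaning to all trees by the very same clauses, no typing argument is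
needed. -/
theorem holds_PhiReg (w : UPWord AP) (B : ℕ) : (PhiReg n w B).Holds E.val := by
  rw [PSLLearning.holds_PhiReg]
  simp only [val_x, val_z]
  refine ⟨?_, ?_, ?_, ?_, ?_, ?_, ?_⟩
  · intro k hk hkn hx i j hij hj
    cases hs : E.node k <;> simp [hs, label] at hx
    rfl
  · intro p k hk hkn hx i j hij hj
    cases hs : E.node k <;> simp [hs, label] at hx
    subst hx
    rfl
  · intro k hkn m hm hmk hx hl i j hij hj
    rw [node_of_val_l (by omega) hkn (by simp [hx, Label.Inner]) hl]
    cases hs : E.node k <;> simp [hs, label] at hx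
    rfl
  · intro k hkn m hm hmk m' hm' hmk' hx hl hr i j hij hj
    rw [node_of_val_l (by omega) hkn (by simp [hx, Label.Inner]) hl,
      node_of_val_r (by omega) hkn (by simp [hx, Label.Inner]) hr]
    cases hs : E.node k <;> simp [hs, label] at hx
    rfl
  · intro k hkn m hm hmk m' hm' hmk' hx hl hr i j hij hj
    rw [node_of_val_l (by omega) hkn (by simp [hx, Label.Inner]) hl,
      node_of_val_r (by omega) hkn (by simp [hx, Label.Inner]) hr]
    cases hs : E.node k <;> simp [hs, label] at hx
    rfl
  · intro k hkn m hm hmk m' hm' hmk' hx hl hr i j hij hj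
    rw [node_of_val_l (by omega) hkn (by simp [hx, Label.Inner]) hl,
      node_of_val_r (by omega) hkn (by simp [hx, Label.Inner]) hr]
    cases hs : E.node k <;> simp [hs, label] at hx
    simp only [Matches, left, right, Nat.lt_succ_iff, and_assoc]
  · intro k hkn m hm hmk hx hl i j hij hj
    rw [node_of_val_l (by omega) hkn (by simp [hx, Label.Inner]) hl]
    cases hs : E.node k <;> simp [hs, label] at hx
    simp only [Matches, left, Nat.lt_succ_iff, and_assoc, Nat.add_one_le_iff]
    exact starMatch_iff

theorem holds_PhiLTL (w : UPWord AP) (hn : t.subtrees.card ≤ n) :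
    (PhiLTL n w (w.luvb (2 ^ n + 1))).Holds E.val := by
  rw [PSLLearning.holds_PhiLTL]
  simp only [val_x, val_z, val_y]
  refine ⟨?_, ?_, ?_, ?_, ?_, ?_⟩
  · intro p k hk hkn hx i hi
    cases hs : E.node k <;> simp [hs, label] at hx
    subst hx
    rfl
  · intro k hkn m hm hmk hx hl i hi
    rw [node_of_val_l (by omega) hkn (by simp [hx, Label.Inner]) hl]
    cases hs : E.node k <;> simp [hs, label] at hx
    rfl
  · intro k hkn m hm hmk m' hm' hmk' hx hl hr i hi
    rw [node_of_val_l (by omega) hkn (by simp [hx, Label.Inner]) hl,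
      node_of_val_r (by omega) hkn (by simp [hx, Label.Inner]) hr]
    cases hs : E.node k <;> simp [hs, label] at hx
    rfl
  · intro k hkn m hm hmk hx hl
    rw [node_of_val_l (by omega) hkn (by simp [hx, Label.Inner]) hl]
    cases hs : E.node k <;> simp [hs, label] at hx
    exact ⟨fun i hi => Iff.rfl, w.satAt_next_iff⟩
  · intro k hkn m hm hmk m' hm' hmk' hx hl hr
    rw [node_of_val_l (by omega) hkn (by simp [hx, Label.Inner]) hl,
      node_of_val_r (by omega) hkn (by simp [hx, Label.Inner]) hr]
    cases hs : E.node k <;> simp [hs, label] at hx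
    exact ⟨fun i hi => w.satAt_untl_iff_of_lt hi, fun i hi => w.satAt_untl_iff_of_ge hi.1 hi.2⟩
  · intro k hkn m hm hmk m' hm' hmk' hx hl hr i hi
    rw [node_of_val_l (by omega) hkn (by simp [hx, Label.Inner]) hl,
      node_of_val_r (by omega) hkn (by simp [hx, Label.Inner]) hr]
    -- The argument of a trigger is a subtree of `t`, so `2^n + 1` unrollings suffice for it too.
    have hc := (Finset.card_le_card (subtrees_subset (left_mem (E := E) (k := k) (by omega) hkn))).trans
      hn
    cases hs : E.node k <;> simp [hs, label] at hx
    rw [hs] at hc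
    rw [left] at hc
    rw [w.satAt_trig_iff hc hi]
    simp only [left, right, Nat.lt_succ_iff, and_imp, Nat.add_one_le_iff]

end SynTree.Numbering

/-! ### Types of subtrees -/

section Typing

variable {AP : Type*}

theorem AtomExpr.exists_of_mem_subtrees [DecidableEq AP] (ξ : AtomExpr AP) {s : SynTree AP}
    (h : s ∈ ξ.tree.subtrees) : ∃ ξ' : AtomExpr AP, s = ξ'.tree := by
  induction ξ with
  | prop p => exact ⟨.prop p, by simpa [tree, SynTree.subtrees] using h⟩
  | neg ξ ih =>
    simp only [tree, SynTree.subtrees, Finset.mem_insert] at h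
    rcases h with rfl | h
    exacts [⟨.neg ξ, rfl⟩, ih h]
  | or ξ₁ ξ₂ ih₁ ih₂ =>
    simp only [tree, SynTree.subtrees, Finset.mem_insert, Finset.mem_union] at h
    rcases h with rfl | h | h
    exacts [⟨.or ξ₁ ξ₂, rfl⟩, ih₁ h, ih₂ h]

theorem RegExpr.exists_of_mem_subtrees [DecidableEq AP] (ρ : RegExpr AP) {s : SynTree AP}
    (h : s ∈ ρ.tree.subtrees) : ∃ ρ' : RegExpr AP, s = ρ'.tree := by
  induction ρ with
  | eps => exact ⟨.eps, by simpa [tree, SynTree.subtrees] using h⟩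
  | atom ξ =>
    obtain ⟨ξ', h⟩ := ξ.exists_of_mem_subtrees h
    exact ⟨.atom ξ', h⟩
  | star ρ ih =>
    simp only [tree, SynTree.subtrees, Finset.mem_insert] at h
    rcases h with rfl | h
    exacts [⟨.star ρ, rfl⟩, ih h]
  | plus ρ₁ ρ₂ ih₁ ih₂ =>
    simp only [tree, SynTree.subtrees, Finset.mem_insert, Finset.mem_union] at h
    rcases h with rfl | h | h
    exacts [⟨.plus ρ₁ ρ₂, rfl⟩, ih₁ h, ih₂ h]
  | comp ρ₁ ρ₂ ih₁ ih₂ =>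
    simp only [tree, SynTree.subtrees, Finset.mem_insert, Finset.mem_union] at h
    rcases h with rfl | h | h
    exacts [⟨.comp ρ₁ ρ₂, rfl⟩, ih₁ h, ih₂ h]

/-- The tree is the syntax tree of a formula or of a regular expression. -/
def SynTree.Typed (s : SynTree AP) : Prop :=
  (∃ φ : PSL AP, s = φ.tree) ∨ ∃ ρ : RegExpr AP, s = ρ.tree

theorem PSL.typed_of_mem_subtrees [DecidableEq AP] (φ : PSL AP) {s : SynTree AP}
    (h : s ∈ φ.tree.subtrees) : s.Typed := by
  induction φ with
  | prop p => exact .inl ⟨.prop p, by simpa [tree, SynTree.subtrees] using h⟩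
  | neg φ ih =>
    simp only [tree, SynTree.subtrees, Finset.mem_insert] at h
    rcases h with rfl | h
    exacts [.inl ⟨.neg φ, rfl⟩, ih h]
  | next φ ih =>
    simp only [tree, SynTree.subtrees, Finset.mem_insert] at h
    rcases h with rfl | h
    exacts [.inl ⟨.next φ, rfl⟩, ih h]
  | or φ₁ φ₂ ih₁ ih₂ =>
    simp only [tree, SynTree.subtrees, Finset.mem_insert, Finset.mem_union] at h
    rcases h with rfl | h | h
    exacts [.inl ⟨.or φ₁ φ₂, rfl⟩, ih₁ h, ih₂ h]
  | untl φ₁ φ₂ ih₁ ih₂ =>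
    simp only [tree, SynTree.subtrees, Finset.mem_insert, Finset.mem_union] at h
    rcases h with rfl | h | h
    exacts [.inl ⟨.untl φ₁ φ₂, rfl⟩, ih₁ h, ih₂ h]
  | trig ρ φ ih =>
    simp only [tree, SynTree.subtrees, Finset.mem_insert, Finset.mem_union] at h
    rcases h with rfl | h | h
    exacts [.inl ⟨.trig ρ φ, rfl⟩, .inr (ρ.exists_of_mem_subtrees h), ih h]

theorem AtomExpr.label_tree [Fintype AP] (ξ : AtomExpr AP) : ξ.tree.label ∈ labA AP := by
  cases ξ <;> simp [tree, SynTree.label, mem_labA]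

theorem RegExpr.label_tree [Fintype AP] (ρ : RegExpr AP) : ρ.tree.label ∈ labR AP := by
  cases ρ with
  | atom ξ => cases ξ <;> simp [tree, AtomExpr.tree, SynTree.label, mem_labR]
  | _ => simp [tree, SynTree.label, mem_labR]

theorem PSL.label_tree [Fintype AP] (φ : PSL AP) : φ.tree.label ∈ labF AP := by
  cases φ <;> simp [tree, SynTree.label, mem_labF]

theorem AtomExpr.label_tree_mem_labF [Fintype AP] (ξ : AtomExpr AP) : ξ.tree.label ∈ labF AP := by
  cases ξ <;> simp [tree, SynTree.label, mem_labF]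

theorem RegExpr.exists_atom (ρ : RegExpr AP) (h : ρ.tree.label = .neg ∨ ρ.tree.label = .or) :
    ∃ ξ : AtomExpr AP, ξ.tree = ρ.tree := by
  cases ρ with
  | atom ξ => exact ⟨ξ, rfl⟩
  | _ => simp [tree, SynTree.label] at h

namespace SynTree.Typed

variable {s : SynTree AP}

theorem children_of_reg (h : s.Typed) (hs : s.label = .plus ∨ s.label = .star ∨ s.label = .comp) :
    ∃ ρ ρ' : RegExpr AP, s.left = ρ.tree ∧ s.right = ρ'.tree := by
  rcases h with ⟨φ, rfl⟩ | ⟨ρ, rfl⟩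
  · cases φ <;> simp [PSL.tree, label] at hs
  · cases ρ with
    | atom ξ => cases ξ <;> simp [RegExpr.tree, AtomExpr.tree, label] at hs
    | eps => simp [RegExpr.tree, label] at hs
    | star ρ => exact ⟨ρ, ρ, rfl, rfl⟩
    | plus ρ ρ' => exact ⟨ρ, ρ', rfl, rfl⟩
    | comp ρ ρ' => exact ⟨ρ, ρ', rfl, rfl⟩

theorem children_of_trig (h : s.Typed) (hs : s.label = .trig) :
    ∃ (ρ : RegExpr AP) (φ : PSL AP), s.left = ρ.tree ∧ s.right = φ.tree := by
  rcases h with ⟨φ, rfl⟩ | ⟨ρ, rfl⟩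
  · cases φ with
    | trig ρ φ => exact ⟨ρ, φ, rfl, rfl⟩
    | _ => simp [PSL.tree, label] at hs
  · cases ρ with
    | atom ξ => cases ξ <;> simp [RegExpr.tree, AtomExpr.tree, label] at hs
    | _ => simp [RegExpr.tree, label] at hs

/-- For `¬` and `∨` the tree may be an atomic expression inside a regular expression; the labels of
its children still lie in `Λ_F`. -/
theorem children_of_form [Fintype AP] (h : s.Typed)
    (hs : s.label = .next ∨ s.label = .untl ∨ s.label = .neg ∨ s.label = .or) :
    s.left.label ∈ labF AP ∧ s.right.label ∈ labF AP := by
  rcases h with ⟨φ, rfl⟩ | ⟨ρ, rfl⟩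
  · cases φ <;> simp [PSL.tree, label] at hs <;> simp [PSL.tree, left, right, PSL.label_tree]
  · cases ρ with
    | atom ξ =>
      cases ξ <;> simp [RegExpr.tree, AtomExpr.tree, label] at hs <;>
        simp [RegExpr.tree, AtomExpr.tree, left, right, AtomExpr.label_tree_mem_labF]
    | _ => simp [RegExpr.tree, label] at hs

end SynTree.Typed

end Typing

/-! ### From consistent formulas to models of the encoding. -/

section Model

variable {AP : Type*} [DecidableEq AP]

theorem PSL.size_pos (φ : PSL AP) : 1 ≤ φ.size :=
  Finset.card_pos.2 ⟨_, φ.tree.self_mem_subtrees⟩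

namespace SynTree.Numbering

variable {t : SynTree AP} {n : ℕ} (E : t.Numbering n)

theorem holds_strLeft : (strLeft n).Holds E.val := by
  rw [PSLLearning.holds_strLeft]
  intro k hk hkn
  refine ⟨_, ⟨?_, ?_, decide_eq_true rfl⟩, fun m' _ _ h => of_decide_eq_true h⟩
  · split_ifs with h
    exacts [E.idx_pos (left_mem (by omega) hkn), le_rfl]
  · split_ifs with h
    exacts [idx_left_lt (by omega) hkn h, hk]

theorem holds_strRight : (strRight n).Holds E.val := by
  rw [PSLLearning.holds_strRight]
  intro k hk hkn
  refine ⟨_, ⟨?_, ?_, decide_eq_true rfl⟩, fun m' _ _ h => of_decide_eq_true h⟩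
  · split_ifs with h
    exacts [E.idx_pos (right_mem (by omega) hkn), le_rfl]
  · split_ifs with h
    exacts [idx_right_lt (by omega) hkn h, hk]

theorem holds_strOrder {L LL LR : List (Label AP)} (hL : ∀ c ∈ L, c.Inner)
    (h : ∀ s ∈ t.subtrees, s.label ∈ L → s.left.label ∈ LL ∧ s.right.label ∈ LR) :
    (strOrder n L LL LR).Holds E.val := by
  rw [PSLLearning.holds_strOrder]
  simp only [val_x]
  intro k hkn m hm hmk m' hm' hmk' c hc hx hl hr
  have hin : (E.node k).label.Inner := hx ▸ hL c hc
  rw [node_of_val_l (by omega) hkn hin hl, node_of_val_r (by omega) hkn hin hr]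
  obtain ⟨h₁, h₂⟩ := h _ (E.node_mem (k := k) (by omega) hkn) (hx ▸ hc)
  exact ⟨⟨_, h₁, rfl⟩, ⟨_, h₂, rfl⟩⟩

theorem holds_strAtomic [Fintype AP] (ht : ∀ s ∈ t.subtrees, s.Typed) :
    (strAtomic n).Holds E.val := by
  rw [PSLLearning.holds_strAtomic]
  simp only [val_x, val_a]
  refine ⟨?_, ?_, ?_, ?_, ?_⟩
  · rintro k hk hkn ⟨ξ, hξ⟩
    exact ⟨_, hξ ▸ ξ.label_tree, rfl⟩
  · rintro k hkn m hm hmk c hc ⟨ξ, hξ⟩ hx hl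
    rw [node_of_val_l (by omega) hkn (by rcases hc with rfl | rfl <;> simp [hx, Label.Inner]) hl]
    rw [← hξ] at hx ⊢
    cases ξ with
    | prop p => rcases hc with rfl | rfl <;> simp [AtomExpr.tree, label] at hx
    | neg ξ => exact ⟨ξ, rfl⟩
    | or ξ ξ' => exact ⟨ξ, rfl⟩
  · rintro k hkn m hm hmk ⟨ξ, hξ⟩ hx hr
    rw [node_of_val_r (by omega) hkn (by simp [hx, Label.Inner]) hr]
    rw [← hξ] at hx ⊢
    cases ξ with
    | or ξ ξ' => exact ⟨ξ', rfl⟩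
    | _ => simp [AtomExpr.tree, label] at hx
  · intro k hkn m hm hmk c hc hx hl
    rw [node_of_val_l (by omega) hkn
      (by rcases hc with rfl | rfl | rfl | rfl <;> simp [hx, Label.Inner]) hl]
    have hk := ht _ (E.node_mem (k := k) (by omega) hkn)
    obtain ⟨ρ, hρ⟩ : ∃ ρ : RegExpr AP, (E.node k).left = ρ.tree := by
      rcases hc with rfl | rfl | rfl | rfl
      · obtain ⟨ρ, _, h, _⟩ := hk.children_of_reg (by simp [hx]); exact ⟨ρ, h⟩
      · obtain ⟨ρ, _, h, _⟩ := hk.children_of_reg (by simp [hx]); exact ⟨ρ, h⟩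
      · obtain ⟨ρ, _, h, _⟩ := hk.children_of_reg (by simp [hx]); exact ⟨ρ, h⟩
      · obtain ⟨ρ, _, h, _⟩ := hk.children_of_trig hx; exact ⟨ρ, h⟩
    rw [hρ]
    exact ρ.exists_atom
  · intro k hkn m hm hmk c hc hx hr
    rw [node_of_val_r (by omega) hkn (by rcases hc with rfl | rfl <;> simp [hx, Label.Inner]) hr]
    have hk := ht _ (E.node_mem (k := k) (by omega) hkn)
    obtain ⟨_, ρ, _, hρ⟩ := hk.children_of_reg (by rcases hc with rfl | rfl <;> simp [hx])
    rw [hρ]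
    exact ρ.exists_atom

end SynTree.Numbering

variable [Fintype AP]

theorem PSL.holds_PhiStr (φ : PSL AP) {n : ℕ} (hn : 1 ≤ n) (E : φ.tree.Numbering n) :
    (PhiStr n).Holds E.val := by
  have ht : ∀ s ∈ φ.tree.subtrees, s.Typed := fun s hs => φ.typed_of_mem_subtrees hs
  rw [PSLLearning.holds_PhiStr]
  refine ⟨?_, E.holds_strLeft, E.holds_strRight, E.holds_strOrder ?_ ?_, E.holds_strOrder ?_ ?_,
    E.holds_strOrder ?_ ?_, E.holds_strAtomic ht, ?_⟩
  · rw [holds_strLabel]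
    simp only [SynTree.Numbering.val_x]
    exact ⟨fun k _ _ => ⟨_, rfl⟩, fun k _ _ c d hc hd => hc.symm.trans hd⟩
  · simp [Label.Inner]
  · intro s hs hl
    obtain ⟨ρ, ρ', h, h'⟩ := (ht s hs).children_of_reg (by simpa using hl)
    rw [h, h']
    exact ⟨ρ.label_tree, ρ'.label_tree⟩
  · simp [Label.Inner]
  · intro s hs hl
    exact (ht s hs).children_of_form (by simpa using hl)
  · simp [Label.Inner]
  · intro s hs hl
    obtain ⟨ρ, ψ, h, h'⟩ := (ht s hs).children_of_trig (by simpa using hl)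
    rw [h, h']
    exact ⟨ρ.label_tree, ψ.label_tree⟩
  · rw [holds_strEnds]
    simp only [SynTree.Numbering.val_x, E.node_root]
    refine ⟨?_, _, φ.label_tree, rfl⟩
    -- An inner tree at node 1 would need a child with a smaller positive number, so the label there
    -- is `ε` or a proposition.
    have := SynTree.Numbering.not_inner_node_one (E := E) hn
    simp only [Label.Inner] at this
    grind

theorem satisfiable_of_consistent {S : Sample AP} {φ : PSL AP} (hφ : S.Consistent φ) :
    (Phi S φ.size).Satisfiable := by
  obtain ⟨E⟩ := φ.tree.nonempty_numbering
  refine ⟨E.val, ?_⟩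
  rw [Phi, PropForm.holds_and]
  refine ⟨φ.holds_PhiStr φ.size_pos E, ?_⟩
  have hw (w : UPWord AP) : (PhiWord φ.size w).Holds E.val :=
    (PropForm.holds_and _ _).2 ⟨E.holds_PhiReg w _, E.holds_PhiLTL w le_rfl⟩
  have hy (w : UPWord AP) : E.val (.y w 0 φ.size) = true ↔ Sat w.word φ := by
    rw [E.val_y, PSL.size, E.node_root, PSL.satAt_tree_zero]
  simp only [PhiCst, holds_and, holds_bigAnd, Finset.mem_toList, holds_neg, holds_var]
  exact ⟨fun w h => ⟨hw w, (hy w).2 (hφ.1 w h)⟩,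
    fun w h => ⟨hw w, fun h' => hφ.2 w h ((hy w).1 h')⟩⟩

end Model

/-! ### Sizes of consistent formulas -/

section Consistency

variable {AP : Type*}

/-- Sharing makes this padding step cost exactly one node, and it preserves the meaning; so
consistent formulas exist in every size from the first one on. -/
theorem PSL.size_or_self [DecidableEq AP] (φ : PSL AP) : (φ.or φ).size = φ.size + 1 := by
  simp only [size, tree, SynTree.subtrees, Finset.union_self]
  refine Finset.card_insert_of_notMem fun h => ?_
  have := SynTree.sizeOf_le_of_mem_subtrees h
  simp at this

theorem Sample.exists_consistent_of_size_le [DecidableEq AP] {S : Sample AP} {φ : PSL AP}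
    (hφ : S.Consistent φ) {n : ℕ} (hn : φ.size ≤ n) : ∃ ψ, S.Consistent ψ ∧ ψ.size = n := by
  induction n, hn using Nat.le_induction with
  | base => exact ⟨φ, hφ, rfl⟩
  | succ n _ ih =>
    obtain ⟨ψ, h, rfl⟩ := ih
    refine ⟨ψ.or ψ, ?_, ψ.size_or_self⟩
    simpa only [Sample.Consistent, Sat, or_self] using h

theorem exists_sat_iff_sat_suffix (φ : PSL AP) (i : ℕ) :
    ∃ ψ : PSL AP, ∀ α : InfWord AP, Sat α ψ ↔ Sat (α.suffix i) φ := by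
  induction i with
  | zero => exact ⟨φ, fun α => by rw [← PSL.satAt_tree, PSL.satAt_tree_zero]⟩
  | succ i ih =>
    obtain ⟨ψ, h⟩ := ih
    exact ⟨.next ψ, fun α => by rw [Sat, h, InfWord.suffix_suffix, add_comm]⟩

/-- The words differ at some position `i` in some proposition `p`, and X^i p or its negation tells
them apart. -/
theorem exists_separating {α β : InfWord AP} (h : α ≠ β) :
    ∃ φ : PSL AP, Sat α φ ∧ ¬ Sat β φ := by
  obtain ⟨i, hi⟩ := Function.ne_iff.1 h
  obtain ⟨p, hp⟩ : ∃ p, ¬ (p ∈ α i ↔ p ∈ β i) := by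
    by_contra hc
    push Not at hc
    exact hi (Finset.ext hc)
  obtain ⟨ψ, hψ⟩ := exists_sat_iff_sat_suffix (.prop p) i
  have hα : Sat α ψ ↔ p ∈ α i := hψ α
  have hβ : Sat β ψ ↔ p ∈ β i := hψ β
  by_cases hpα : p ∈ α i
  · exact ⟨ψ, by tauto, by tauto⟩
  · exact ⟨.neg ψ, by simp only [Sat]; tauto, by simp only [Sat]; tauto⟩

theorem exists_separating_finset [Nonempty AP] {α : InfWord AP} (F : Finset (UPWord AP))
    (h : ∀ w ∈ F, α ≠ w.word) : ∃ φ : PSL AP, Sat α φ ∧ ∀ w ∈ F, ¬ Sat w.word φ := by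
  classical
  induction F using Finset.induction_on with
  | empty =>
    let p : AP := Classical.arbitrary AP
    exact ⟨.or (.prop p) (.neg (.prop p)), by simp only [Sat]; tauto, by simp⟩
  | insert a F _ ih =>
    obtain ⟨φ, h₁, h₂⟩ := ih fun w hw => h w (Finset.mem_insert_of_mem hw)
    obtain ⟨ψ, h₃, h₄⟩ := exists_separating (h a (Finset.mem_insert_self _ _))
    refine ⟨.neg (.or (.neg φ) (.neg ψ)), by simp only [Sat]; tauto, fun w hw => ?_⟩
    simp only [Sat]
    rcases Finset.mem_insert.1 hw with rfl | hw
    · tauto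
    · have := h₂ w hw
      tauto

/-- A disjunction over the positive words of formulas, each of which is true of its word and false
of all negative words. -/
theorem Sample.exists_consistent [Nonempty AP] (S : Sample AP) : ∃ φ, S.Consistent φ := by
  classical
  suffices ∀ F ⊆ S.P, ∃ φ : PSL AP, (∀ w ∈ F, Sat w.word φ) ∧ ∀ w ∈ S.N, ¬ Sat w.word φ from
    this S.P subset_rfl
  intro F
  induction F using Finset.induction_on with
  | empty =>
    intro _
    let p : AP := Classical.arbitrary AP
    exact ⟨.neg (.or (.prop p) (.neg (.prop p))), by simp, fun w _ => by simp only [Sat]; tauto⟩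
  | insert a F _ ih =>
    intro hF
    obtain ⟨φ, h₁, h₂⟩ := ih ((Finset.subset_insert _ _).trans hF)
    obtain ⟨ψ, h₃, h₄⟩ := exists_separating_finset S.N
      (S.disjoint a (hF (Finset.mem_insert_self _ _)))
    refine ⟨.or φ ψ, fun w hw => ?_, fun w hw => ?_⟩
    · rcases Finset.mem_insert.1 hw with rfl | hw
      exacts [.inr h₃, .inl (h₁ w hw)]
    · exact not_or.2 ⟨h₂ w hw, h₄ w hw⟩

end Consistency

/-! ### Runs of the algorithm -/

section Runs

variable {AP : Type*} [Fintype AP] [DecidableEq AP] {S : Sample AP}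

theorem satisfiable_iff_exists_consistent {n : ℕ} (hn : 1 ≤ n) :
    (Phi S n).Satisfiable ↔ ∃ φ, S.Consistent φ ∧ φ.size = n := by
  constructor
  · rintro ⟨v, hv⟩
    obtain ⟨φ, -, -, h, hle⟩ := exists_extracts hn hv
    exact Sample.exists_consistent_of_size_le h hle
  · rintro ⟨φ, h, rfl⟩
    exact satisfiable_of_consistent h

/-- What holds of the configurations that occur in runs: the values of the counter that have been
passed gave unsatisfiable formulas, and a model or a formula stems from the next one. -/
def Config.Invariant (S : Sample AP) : Config AP → Prop
  | .loop n => ∀ m, 1 ≤ m → m ≤ n → ¬ (Phi S m).Satisfiable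
  | .solved n v => 1 ≤ n ∧ (Phi S n).Holds v ∧ ∀ m, 1 ≤ m → m < n → ¬ (Phi S m).Satisfiable
  | .returned φ => ∃ n v, 1 ≤ n ∧ (Phi S n).Holds v ∧ Extracts v n φ ∧
      ∀ m, 1 ≤ m → m < n → ¬ (Phi S m).Satisfiable

theorem Reachable.invariant {c : Config AP} (h : Reachable S c) : c.Invariant S := by
  induction h with
  | refl => intro m h₁ h₂; omega
  | tail _ hstep ih =>
    cases hstep with
    | @unsat n h =>
      intro m h₁ h₂
      rcases Nat.lt_or_ge n m with hm | hm
      · obtain rfl : m = n + 1 := by omega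
        exact h
      · exact ih m h₁ hm
    | @sat n v h => exact ⟨by omega, h, fun m h₁ h₂ => ih m h₁ (by omega)⟩
    | @ret n v φ h => exact ⟨n, v, ih.1, ih.2.1, h, ih.2.2⟩

theorem not_exists_infinite_run [Nonempty AP] : ¬ ∃ c : ℕ → Config AP,
    c 0 = .loop 0 ∧ ∀ i, Step S (c i) (c (i + 1)) := by
  rintro ⟨c, hc₀, hc⟩
  have hloop (i : ℕ) : c i = .loop i := by
    induction i with
    | zero => exact hc₀
    | succ i ih =>
      -- Three consecutive steps are inspected: once the loop is left, one step returns a formula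
      -- and a third step is impossible. An infinite run would thus stay in the loop forever.
      have h₁ := hc i
      have h₂ := hc (i + 1)
      have h₃ := hc (i + 1 + 1)
      rw [ih] at h₁
      generalize c (i + 1) = d at *
      generalize c (i + 1 + 1) = d' at *
      cases h₁ with
      | unsat => rfl
      | sat =>
        cases h₂
        cases h₃
  obtain ⟨φ, hφ⟩ := S.exists_consistent
  obtain ⟨k, hk⟩ : ∃ k, φ.size = k + 1 := ⟨φ.size - 1, by have := φ.size_pos; omega⟩
  have h := hc k
  rw [hloop, hloop] at h
  cases h with
  | unsat h => exact h (hk ▸ satisfiable_of_consistent hφ)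

theorem Reachable.eq_returned {c : Config AP} (h : Reachable S c) (hc : ∀ c', ¬ Step S c c') :
    ∃ φ, c = .returned φ := by
  cases c with
  | loop n =>
    by_cases hs : (Phi S (n + 1)).Satisfiable
    · obtain ⟨v, hv⟩ := hs
      exact (hc _ (.sat hv)).elim
    · exact (hc _ (.unsat hs)).elim
  | solved n v =>
    -- The invariant guarantees that `v` is a model, so a formula can be extracted and the run is
    -- not stuck here.
    obtain ⟨hn, hv, -⟩ := h.invariant
    obtain ⟨φ, hφ, -⟩ := exists_extracts hn hv
    exact (hc _ (.ret hφ)).elim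
  | returned φ => exact ⟨φ, rfl⟩

theorem Reachable.consistent_and_minimal {φ : PSL AP} (h : Reachable S (.returned φ)) :
    S.Consistent φ ∧ ∀ ψ, S.Consistent ψ → φ.size ≤ ψ.size := by
  obtain ⟨n, v, hn, hv, hext, hmin⟩ := h.invariant
  obtain ⟨φ', -, huniq, hcons, hsize⟩ := exists_extracts hn hv
  obtain rfl := huniq φ hext
  -- It suffices that no consistent formula has size below `n`: its size would have been a
  -- satisfiable counter value passed earlier.
  refine ⟨hcons, fun ψ hψ => hsize.trans ?_⟩
  by_contra hlt
  exact hmin ψ.size ψ.size_pos (not_le.1 hlt) (satisfiable_of_consistent hψ)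

end Runs

end PSLLearning

theorem mainTheorem1 {AP : Type*} [Fintype AP] [DecidableEq AP] [Nonempty AP]
    (S : PSLLearning.Sample AP) :
    -- every run of the algorithm is finite
    (¬ ∃ c : ℕ → PSLLearning.Config AP,
      c 0 = .loop 0 ∧ ∀ i, PSLLearning.Step S (c i) (c (i + 1))) ∧
    -- a run can only stop by returning a formula
    (∀ c, PSLLearning.Reachable S c → (∀ c', ¬ PSLLearning.Step S c c') →
      ∃ φ, c = .returned φ) ∧
    -- every returned formula is consistent with `S` and of minimal size
    (∀ φ, PSLLearning.Reachable S (.returned φ) →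
      S.Consistent φ ∧ ∀ ψ, S.Consistent ψ → φ.size ≤ ψ.size) ∧
    -- the encoding is satisfiable exactly for the sizes of consistent formulas, and every model
    -- of it determines a formula, which is consistent
    (∀ n, 1 ≤ n →
      ((PSLLearning.Phi S n).Satisfiable ↔ ∃ φ, S.Consistent φ ∧ φ.size = n) ∧
      ∀ v, (PSLLearning.Phi S n).Holds v →
        ∃ φ, PSLLearning.Extracts v n φ ∧ (∀ ψ, PSLLearning.Extracts v n ψ → ψ = φ) ∧
          S.Consistent φ ∧ φ.size ≤ n) := by
  exact ⟨PSLLearning.not_exists_infinite_run, fun _ h => h.eq_returned,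
    fun _ h => h.consistent_and_minimal, fun _ hn =>
      ⟨PSLLearning.satisfiable_iff_exists_consistent hn, fun _ => PSLLearning.exists_extracts hn⟩⟩
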